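/- **Setting.** A *chart* on a set $X$ is a map $k:U\to X$ with $U\subset\mathbb R$ open; a *morphism* $k_1\to k_2$ of charts is a local diffeomorphism $h:U_1\to U_2$ of their domains with $k_1=k_2\circ h$. For $U\subset\mathbb R$ open let $S(U)$ be the space of frames of infinite order of $U$, i.e. of $\infty$-jets at $0$ of smooth germs $k:(\mathbb R,0)\to U$ with $k'(0)\neq 0$, with coordinates $x_p=k^{(p)}(0)$ ($p\ge 0$). The group $\mathrm{GL}(1,\mathbb R)=\mathbb R^*$ acts by $\lambda\cdot(x_p)=(\lambda^p x_p)$, and $y_0=x_0$, $y_p=x_p/x_1^p$ ($p\ge 2$) are coordinates on $S(U)/\mathrm{GL}(1,\mathbb R)$, which is thereby an open subset of $\mathbb R^\infty$ with the product topology. A smooth $p$-form on it is one that near each point is the pull-back of a smooth $p$-form in finitely many of the coordinates. A morphism $h$ induces a map $S(U_1)/\mathrm{GL}(1,\mathbb R)\to S(U_2)/\mathrm{GL}(1,\mathbb R)$ by $j^\infty_0k\mapsto j^\infty_0(h\circ k)$. For a set $\Phi$ of charts on $X$, an element of $\Omega^p(S(X)/\mathrm{GL}(1,\mathbb R))$ is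 a family of smooth $p$-forms, one on $S(U)/\mathrm{GL}(1,\mathbb R)$ for each chart $k:U\to X$ in $\Phi$, compatible with the pull-backs by all morphisms between charts of $\Phi$; the differential $d$ is the exterior derivative in each chart. The first Chern class $c_1$ is represented by the family of 2-forms equal to $dy_2\wedge dy_0$ in each chart. *Reeb foliation.* Let $f,g$ be smooth functions on $(-1,1)$ such that each $\phi\in\{f,g\}$ satisfies $\phi(0)=0$, $\phi\ge 0$, $\phi(-t)=\phi(t)$ and, for all $p\ge 0$, $$\lim_{t\to\pm1}\bigl|\phi^{(p)}(t)\bigr|=\infty,\qquad \lim_{t\to\pm 1}\frac{d^p}{dt^p}\frac{1}{\phi'(t)}=0 .$$ Let $S^3=\{(x,y)\in\mathbb C^2:|x|^2+|y|^2=2\}$. The leaves of the Reeb foliation $\mathfrak F$ given by $f$ and $g$ are the torus $|x|=|y|=1$ and, for $a\in\mathbb R$, the sets $$\{(x,y)\in S^3:\ |x|<1,\ y=|y|e^{2\pi i(a+f(|x|))}\},\qquad \{(x,y)\in S^3:\ |y|<1,\ x=|x|e^{2\pi i(a+g(|y|))}\}.$$ The leaf space $S^3/\mathfrak F$ is the set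 of leaves. Its charts are the smooth maps $U\to S^3$, $U\subset\mathbb R$ open, that are transverse to the leaves, followed by the map sending a point to its leaf. For a smooth 1-manifold $M$ the charts are all local diffeomorphisms $U\to M$ with $U\subset\mathbb R$ open. **Theorem.** (1) For all such $f$ and $g$, the first Chern form $c_1=dy_2\wedge dy_0$ is a well-defined closed element of $\Omega^2(S(S^3/\mathfrak F)/\mathrm{GL}(1,\mathbb R))$ and it is not exact: there is no $\gamma\in\Omega^1(S(S^3/\mathfrak F)/\mathrm{GL}(1,\mathbb R))$ with $d\gamma=c_1$. Thus the first Chern class is non-trivial in the cohomology of $\Omega^*(S(S^3/\mathfrak F)/\mathrm{GL}(1,\mathbb R))$. (2) In contrast, for every smooth (Hausdorff, second countable) manifold $M$ of dimension one without boundary, $c_1$ is a well-defined closed element of $\Omega^2(S(M)/\mathrm{GL}(1,\mathbb R))$ and it is exact. -/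

import Mathlib

open Set Filter Topology
open scoped ContDiff Manifold Nat

noncomputable section

/-! ### Charts on a set and their morphisms -/

/-- A chart on the set `X` with domain an open subset of the line. -/
structure LineChart (X : Type*) where
  dom : TopologicalSpace.Opens ℝ
  toFun : dom → X

/-- `h` (considered on the domain of `k₁` only) is a morphism of charts `k₁ → k₂`: an étale map
(local diffeomorphism) from the domain of `k₁` to the domain of `k₂` with `k₁ = k₂ ∘ h`. -/
structure IsChartMorphism {X : Type*} (k₁ k₂ : LineChart X) (h : ℝ → ℝ) : Prop where
  smooth : ContDiffOn ℝ ∞ h k₁.dom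
  etale : ∀ u ∈ k₁.dom, deriv h u ≠ 0
  comp : ∀ u (hu : u ∈ k₁.dom), ∃ hv : h u ∈ k₂.dom, k₂.toFun ⟨h u, hv⟩ = k₁.toFun ⟨u, hu⟩

/-! ### Frames of infinite order, modulo `GL(1, ℝ)` -/

/-- Frames of infinite order of an open subset `U` of the line: the `∞`-jets at `0` of smooth maps
`k` from a neighbourhood of `0` to `U` with `k'(0) ≠ 0`, each given by the sequence
`x p = k⁽ᵖ⁾(0)` of its derivatives. -/
def frames (U : Set ℝ) : Set (ℕ → ℝ) := {x | x 0 ∈ U ∧ x 1 ≠ 0}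

/-- The action of `c ∈ GL(1, ℝ)`: the jet of `k` goes to the jet of `s ↦ k (c * s)`. -/
def scaleFrame (c : ℝ) (x : ℕ → ℝ) : ℕ → ℝ := fun p => c ^ p * x p

/-- The map of frames induced by `h`: the jet of `k` goes to the jet of `h ∘ k`. The `p`-th
derivative of `h ∘ k` at `0` depends only on the derivatives of `k` up to order `p`, so that `k`
is replaced here by its Taylor polynomial of degree `p`. -/
def pushFrame (h : ℝ → ℝ) (x : ℕ → ℝ) : ℕ → ℝ := fun p =>
  iteratedDeriv p (fun s => h (∑ i ∈ Finset.range (p + 1), x i / (i ! : ℝ) * s ^ i)) 0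

/-- Indices of the coordinates `y₀, y₂, y₃, …` on frames modulo `GL(1, ℝ)`. -/
abbrev JetIdx : Type := {p : ℕ // p ≠ 1}

/-- The model space of the frames modulo `GL(1, ℝ)`, with the product topology. -/
abbrev JetSpace : Type := JetIdx → ℝ

/-- The index `0`. -/
abbrev idx0 : JetIdx := ⟨0, by decide⟩

/-- The index `2`. -/
abbrev idx2 : JetIdx := ⟨2, by decide⟩

/-- The coordinates `y₀ = x₀`, `yₚ = xₚ / x₁ᵖ` of the class of the frame `x` modulo `GL(1, ℝ)`. -/
def reduceFrame (x : ℕ → ℝ) : JetSpace := fun p => x p / x 1 ^ (p : ℕ)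

/-- The frame with `x₁ = 1` in the class modulo `GL(1, ℝ)` that has the coordinates `y`. -/
def liftFrame (y : JetSpace) : ℕ → ℝ := fun p => if hp : p = 1 then 1 else y ⟨p, hp⟩

/-- The frames of `U` modulo `GL(1, ℝ)`, in the coordinates `y`. -/
def jetDomain (U : Set ℝ) : Set JetSpace := {y | y idx0 ∈ U}

theorem liftFrame_mem (U : Set ℝ) (y : JetSpace) (hy : y ∈ jetDomain U) :
    liftFrame y ∈ frames U := by
  refine ⟨?_, ?_⟩
  · simpa [liftFrame, jetDomain] using hy
  · simp [liftFrame]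

theorem reduceFrame_liftFrame (y : JetSpace) : reduceFrame (liftFrame y) = y := by
  funext p
  simp [reduceFrame, liftFrame, p.2]

theorem reduceFrame_eq_iff (U : Set ℝ) (x x' : ℕ → ℝ) (hx : x ∈ frames U) (hx' : x' ∈ frames U) :
    reduceFrame x = reduceFrame x' ↔ ∃ c : ℝ, c ≠ 0 ∧ x' = scaleFrame c x := by
  have h1 := hx.2
  have h1' := hx'.2
  constructor
  · intro h
    refine ⟨x' 1 / x 1, div_ne_zero h1' h1, ?_⟩
    funext p
    by_cases hp : p = 1
    · subst hp
      simp [scaleFrame, h1]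
    · have := congrFun h ⟨p, hp⟩
      simp only [reduceFrame] at this
      rw [scaleFrame, div_pow]
      field_simp at this ⊢
      linarith
  · rintro ⟨c, hc, rfl⟩
    funext p
    simp only [reduceFrame, scaleFrame, pow_one, mul_pow]
    field_simp

theorem pushFrame_scaleFrame (h : ℝ → ℝ) (c : ℝ) (x : ℕ → ℝ) :
    pushFrame h (scaleFrame c x) = scaleFrame c (pushFrame h x) := by
  have key : ∀ (n : ℕ) (F : ℝ → ℝ),
      iteratedDeriv n (fun s => F (c * s)) = fun s => c ^ n * iteratedDeriv n F (c * s) := by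
    intro n F
    induction n with
    | zero => simp
    | succ n ih =>
      funext s
      rw [iteratedDeriv_succ, ih, iteratedDeriv_succ, deriv_const_mul_field,
        deriv_comp_mul_left, smul_eq_mul]
      ring
  funext p
  have := congrFun (key p
    (fun s => h (∑ i ∈ Finset.range (p + 1), x i / (i ! : ℝ) * s ^ i))) 0
  simp only [mul_zero] at this
  rw [scaleFrame, pushFrame, pushFrame, ← this]
  congr 1
  funext s
  congr 1
  refine Finset.sum_congr rfl fun i _ => ?_
  rw [scaleFrame]
  ring

/-- The map induced by `h` on frames modulo `GL(1, ℝ)`, in the coordinates `y`. -/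
def pushJet (h : ℝ → ℝ) (y : JetSpace) : JetSpace := reduceFrame (pushFrame h (liftFrame y))

/-- The differential of `pushJet h` at `y`: the derivative in the direction `v`, coordinate by
coordinate (each coordinate is a smooth function of finitely many variables). -/
def pushJetDeriv (h : ℝ → ℝ) (y v : JetSpace) : JetSpace := fun j =>
  lineDeriv ℝ (fun z => pushJet h z j) y v

/-! ### Differential forms -/

/-- The restriction of a point of the model space to finitely many coordinates. -/
def restrictCoords (s : Finset JetIdx) : JetSpace →L[ℝ] (s → ℝ) :=
  ContinuousLinearMap.pi fun i : s => ContinuousLinearMap.proj (i : JetIdx)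

/-- `θ` is a smooth `p`-form on the open set `W` of the model space: near each point of `W` it is
the pull-back of a smooth `p`-form in finitely many of the coordinates. -/
def IsSmoothForm {p : ℕ} (W : Set JetSpace) (θ : JetSpace → JetSpace [⋀^Fin p]→L[ℝ] ℝ) : Prop :=
  ∀ y ∈ W, ∃ (s : Finset JetIdx) (η : (s → ℝ) → (s → ℝ) [⋀^Fin p]→L[ℝ] ℝ),
    (∀ᶠ a in 𝓝 (restrictCoords s y), ContDiffAt ℝ ∞ η a) ∧
    ∀ᶠ z in 𝓝 y, θ z = (η (restrictCoords s z)).compContinuousLinearMap (restrictCoords s)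

/-- The exterior derivative:
`(dθ)(v₀, …, vₚ) = ∑ᵢ (-1)ⁱ ∂_{vᵢ} (θ(v₀, …, v̂ᵢ, …, vₚ))` for constant vector fields `vᵢ`. -/
def formDeriv {p : ℕ} (θ : JetSpace → JetSpace [⋀^Fin p]→L[ℝ] ℝ) (y : JetSpace)
    (v : Fin (p + 1) → JetSpace) : ℝ :=
  ∑ i : Fin (p + 1), (-1 : ℝ) ^ (i : ℕ) * lineDeriv ℝ (fun z => θ z (i.removeNth v)) y (v i)

/-- A family `θ` of `p`-forms in the coordinates given by the charts of `Φ` is an element of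
`Ωᵖ(S(X)/GL(1, ℝ))`, where `S(X)` is the space of frames of infinite order of `X`: the form
`θ k` is smooth on the frames of the domain of `k` modulo `GL(1, ℝ)`, and the forms are compatible
with the pull-backs by all morphisms between charts of `Φ`. Only the values of `θ k` for
`k ∈ Φ` at the points of `jetDomain k.dom` matter. -/
structure IsFrameForm {X : Type*} (Φ : Set (LineChart X)) (p : ℕ)
    (θ : LineChart X → JetSpace → JetSpace [⋀^Fin p]→L[ℝ] ℝ) : Prop where
  smooth : ∀ k ∈ Φ, IsSmoothForm (jetDomain k.dom) (θ k)
  compat : ∀ k₁ ∈ Φ, ∀ k₂ ∈ Φ, ∀ h : ℝ → ℝ, IsChartMorphism k₁ k₂ h →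
    ∀ y ∈ jetDomain k₁.dom, ∀ v : Fin p → JetSpace,
      θ k₁ y v = θ k₂ (pushJet h y) (fun i => pushJetDeriv h y (v i))

/-- `dθ = 0` in `Ω*(S(X)/GL(1, ℝ))`. -/
def IsClosedFrameForm {X : Type*} (Φ : Set (LineChart X)) {p : ℕ}
    (θ : LineChart X → JetSpace → JetSpace [⋀^Fin p]→L[ℝ] ℝ) : Prop :=
  ∀ k ∈ Φ, ∀ y ∈ jetDomain k.dom, ∀ v, formDeriv (θ k) y v = 0

/-- `θ = dγ` for some `γ ∈ Ωᵖ(S(X)/GL(1, ℝ))`. -/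
def IsExactFrameForm {X : Type*} (Φ : Set (LineChart X)) {p : ℕ}
    (θ : LineChart X → JetSpace → JetSpace [⋀^Fin (p + 1)]→L[ℝ] ℝ) : Prop :=
  ∃ γ : LineChart X → JetSpace → JetSpace [⋀^Fin p]→L[ℝ] ℝ, IsFrameForm Φ p γ ∧
    ∀ k ∈ Φ, ∀ y ∈ jetDomain k.dom, ∀ v, formDeriv (γ k) y v = θ k y v

/-- The constant 2-form `dy₂ ∧ dy₀` on the model space. -/
def dy2_wedge_dy0 : JetSpace [⋀^Fin 2]→L[ℝ] ℝ where
  toFun v := v 0 idx2 * v 1 idx0 - v 0 idx0 * v 1 idx2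
  map_update_add' v i a b := by
    fin_cases i <;> simp [Function.update] <;> ring
  map_update_smul' v i c a := by
    fin_cases i <;> simp [Function.update] <;> ring
  map_eq_zero_of_eq' v i j hv hij := by
    fin_cases i <;> fin_cases j <;> simp_all [mul_comm]
  cont := by fun_prop

/-- The first Chern form `c₁`: it is `dy₂ ∧ dy₀` in the coordinates of every chart. -/
def firstChernForm (X : Type*) : LineChart X → JetSpace → JetSpace [⋀^Fin 2]→L[ℝ] ℝ :=
  fun _ _ => dy2_wedge_dy0

/-! ### Manifolds of dimension one -/

/-- The charts of a smooth manifold of dimension one: all étale maps from open subsets of the line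
to it. -/
def manifoldCharts (M : Type*) [TopologicalSpace M] [ChartedSpace ℝ M] : Set (LineChart M) :=
  {k | IsLocalDiffeomorph 𝓘(ℝ, ℝ) 𝓘(ℝ, ℝ) ∞ k.toFun}

/-! ### The Reeb foliation of the 3-sphere -/

/-- The functions on `(-1, 1)` that are used to build the Reeb foliation. -/
structure IsReebFunction (f : ℝ → ℝ) : Prop where
  smooth : ContDiffOn ℝ ∞ f (Ioo (-1) 1)
  zero : f 0 = 0
  nonneg : ∀ t ∈ Ioo (-1 : ℝ) 1, 0 ≤ f t
  even : ∀ t ∈ Ioo (-1 : ℝ) 1, f (-t) = f t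
  deriv_right : ∀ p : ℕ, Tendsto (fun t => |iteratedDeriv p f t|) (𝓝[<] 1) atTop
  deriv_left : ∀ p : ℕ, Tendsto (fun t => |iteratedDeriv p f t|) (𝓝[>] (-1)) atTop
  flat_right : ∀ p : ℕ, Tendsto (iteratedDeriv p (fun t => 1 / deriv f t)) (𝓝[<] 1) (𝓝 0)
  flat_left : ∀ p : ℕ, Tendsto (iteratedDeriv p (fun t => 1 / deriv f t)) (𝓝[>] (-1)) (𝓝 0)

/-- The 3-sphere `|x|² + |y|² = 2` in `ℝ² × ℝ² = ℂ × ℂ`. -/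
def sphere3 : Set (ℂ × ℂ) := {q | ‖q.1‖ ^ 2 + ‖q.2‖ ^ 2 = 2}

/-- The compact leaf, the torus `|x| = |y|` of the sphere. -/
def torusLeaf : Set (ℂ × ℂ) := {q | q ∈ sphere3 ∧ ‖q.1‖ = ‖q.2‖}

/-- The leaf with number `a` of the solid torus `|x| ≤ |y|`: the points
`(x, |y| exp (2πi (a + f |x|)))` with `|x| < 1`. -/
def planeLeaf₁ (f : ℝ → ℝ) (a : ℝ) : Set (ℂ × ℂ) :=
  {q | q ∈ sphere3 ∧ ‖q.1‖ < 1 ∧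
    q.2 = ‖q.2‖ * Complex.exp (2 * Real.pi * Complex.I * ((a + f ‖q.1‖ : ℝ) : ℂ))}

/-- The leaf with number `a` of the solid torus `|y| ≤ |x|`: the points
`(|x| exp (2πi (a + g |y|)), y)` with `|y| < 1`. -/
def planeLeaf₂ (g : ℝ → ℝ) (a : ℝ) : Set (ℂ × ℂ) :=
  {q | q ∈ sphere3 ∧ ‖q.2‖ < 1 ∧
    q.1 = ‖q.1‖ * Complex.exp (2 * Real.pi * Complex.I * ((a + g ‖q.2‖ : ℝ) : ℂ))}

/-- The leaves of the Reeb foliation given by `f` and `g`. -/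
def reebLeaves (f g : ℝ → ℝ) : Set (Set (ℂ × ℂ)) :=
  {torusLeaf} ∪ range (planeLeaf₁ f) ∪ range (planeLeaf₂ g)

theorem exists_unit_phase (z : ℂ) :
    ∃ a : ℝ, z = ‖z‖ * Complex.exp (2 * Real.pi * Complex.I * (a : ℂ)) := by
  refine ⟨z.arg / (2 * Real.pi), ?_⟩
  conv_lhs => rw [← Complex.norm_mul_exp_arg_mul_I z]
  congr 2
  have : (Real.pi : ℂ) ≠ 0 := by exact_mod_cast Real.pi_ne_zero
  push_cast
  field_simp

/-- Every point of the sphere lies in exactly one leaf. -/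
theorem existsUnique_reebLeaf (f g : ℝ → ℝ) (q : ℂ × ℂ) (hq : q ∈ sphere3) :
    ∃! L, L ∈ reebLeaves f g ∧ q ∈ L := by
  have hs : ‖q.1‖ ^ 2 + ‖q.2‖ ^ 2 = 2 := hq
  have n1 := norm_nonneg q.1
  have n2 := norm_nonneg q.2
  have phase : ∀ (z : ℂ), z ≠ 0 → ∀ b b' : ℝ,
      z = ‖z‖ * Complex.exp (2 * Real.pi * Complex.I * (b : ℂ)) →
      z = ‖z‖ * Complex.exp (2 * Real.pi * Complex.I * (b' : ℂ)) →
      Complex.exp (2 * Real.pi * Complex.I * (b : ℂ)) =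
        Complex.exp (2 * Real.pi * Complex.I * (b' : ℂ)) := by
    intro z hz b b' h h'
    have hz' : (‖z‖ : ℂ) ≠ 0 := by exact_mod_cast norm_ne_zero_iff.mpr hz
    exact mul_left_cancel₀ hz' (h.symm.trans h')
  have shift : ∀ a a' r r' : ℝ,
      Complex.exp (2 * Real.pi * Complex.I * ((a + r : ℝ) : ℂ)) =
        Complex.exp (2 * Real.pi * Complex.I * ((a' + r : ℝ) : ℂ)) →
      Complex.exp (2 * Real.pi * Complex.I * ((a + r' : ℝ) : ℂ)) =
        Complex.exp (2 * Real.pi * Complex.I * ((a' + r' : ℝ) : ℂ)) := by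
    intro a a' r r' h
    have e : ∀ t : ℝ, Complex.exp (2 * Real.pi * Complex.I * ((t + r' : ℝ) : ℂ)) =
        Complex.exp (2 * Real.pi * Complex.I * ((t + r : ℝ) : ℂ)) *
          Complex.exp (2 * Real.pi * Complex.I * ((r' - r : ℝ) : ℂ)) := by
      intro t
      rw [← Complex.exp_add]
      congr 1
      push_cast
      ring
    rw [e, e, h]
  rcases lt_trichotomy ‖q.1‖ ‖q.2‖ with hlt | heq | hgt
  · have h1 : ‖q.1‖ < 1 := by nlinarith
    have h2 : 1 < ‖q.2‖ := by nlinarith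
    have hne : q.2 ≠ 0 := norm_pos_iff.mp (by linarith)
    obtain ⟨b, hb⟩ := exists_unit_phase q.2
    refine ⟨planeLeaf₁ f (b - f ‖q.1‖), ⟨Or.inl (Or.inr ⟨_, rfl⟩), hq, h1, ?_⟩, ?_⟩
    · simpa using hb
    · rintro L ⟨(hL | ⟨a, rfl⟩) | ⟨a, rfl⟩, hqL⟩
      · rw [mem_singleton_iff] at hL
        subst hL
        exact absurd hqL.2 hlt.ne
      · have hp := phase q.2 hne (a + f ‖q.1‖) (b - f ‖q.1‖ + f ‖q.1‖) hqL.2.2 (by simpa using hb)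
        ext w
        simp only [planeLeaf₁, mem_setOf_eq]
        rw [shift _ _ _ (f ‖w.1‖) hp]
      · exact absurd hqL.2.1 (by linarith)
  · refine ⟨torusLeaf, ⟨Or.inl (Or.inl rfl), hq, heq⟩, ?_⟩
    rintro L ⟨(hL | ⟨a, rfl⟩) | ⟨a, rfl⟩, hqL⟩
    · exact hL
    · have := hqL.2.1
      nlinarith
    · have := hqL.2.1
      nlinarith
  · have h1 : ‖q.2‖ < 1 := by nlinarith
    have h2 : 1 < ‖q.1‖ := by nlinarith
    have hne : q.1 ≠ 0 := norm_pos_iff.mp (by linarith)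
    obtain ⟨b, hb⟩ := exists_unit_phase q.1
    refine ⟨planeLeaf₂ g (b - g ‖q.2‖), ⟨Or.inr ⟨_, rfl⟩, hq, h1, ?_⟩, ?_⟩
    · simpa using hb
    · rintro L ⟨(hL | ⟨a, rfl⟩) | ⟨a, rfl⟩, hqL⟩
      · rw [mem_singleton_iff] at hL
        subst hL
        exact absurd hqL.2 hgt.ne'
      · exact absurd hqL.2.1 (by linarith)
      · have hp := phase q.1 hne (a + g ‖q.2‖) (b - g ‖q.2‖ + g ‖q.2‖) hqL.2.2 (by simpa using hb)
        ext w
        simp only [planeLeaf₂, mem_setOf_eq]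
        rw [shift _ _ _ (g ‖w.2‖) hp]

/-- The leaf space of the Reeb foliation: the set of its leaves. -/
abbrev ReebLeafSpace (f g : ℝ → ℝ) : Type := reebLeaves f g

/-- The tangent vectors at `q` of the leaf `L`: the velocities of the smooth curves in `L`
through `q`. -/
def leafTangent (L : Set (ℂ × ℂ)) (q : ℂ × ℂ) : Set (ℂ × ℂ) :=
  {w | ∃ c : ℝ → ℂ × ℂ, ContDiff ℝ ∞ c ∧ (∀ s, c s ∈ L) ∧ c 0 = q ∧ deriv c 0 = w}

/-- The charts of the leaf space: the smooth maps `σ` from open subsets of the line to the sphere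
that are transverse to the leaves (as the codimension is one: nowhere tangent to them), followed by
the map that sends a point to its leaf. -/
def reebCharts (f g : ℝ → ℝ) : Set (LineChart (ReebLeafSpace f g)) :=
  {k | ∃ σ : ℝ → ℂ × ℂ, ContDiffOn ℝ ∞ σ k.dom ∧
    ∀ u (hu : u ∈ k.dom), σ u ∈ (k.toFun ⟨u, hu⟩ : Set (ℂ × ℂ)) ∧
      deriv σ u ∉ leafTangent (k.toFun ⟨u, hu⟩ : Set (ℂ × ℂ)) (σ u)}

end

/-! ### Jets of maps and the first Chern form -/

/-! Under a morphism `h` the form `y₂ dy₀` becomes `(y₂ + h''/h') dy₀`. Hence `dy₂ ∧ dy₀` is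
invariant, and it is exact as soon as each chart carries a function `G` that transforms like a
Christoffel symbol: `(y₂ + G) dy₀` is then an invariant primitive
(`isExactFrameForm_of_connection`). On a manifold such a `G` is an average, by a partition of unity,
of the symbols `F''/F'` of the flat connections of an atlas.

For the Reeb foliation, suppose that a primitive `γ` exists, and let `θ` be its component in the
chart that numbers the leaves of the first solid torus. The numbers `a` and `a + 1` give the same
leaf, so `θ` is periodic in `y₀`. By compactness of a period, `θ` depends on finitely many
coordinates in a tube around the line `y₂ = y₃ = ⋯ = 0`; there `θ - y₂ dy₀` is closed, so it is `dF`
with `F - c y₀` bounded (`IsSmoothForm.exists_primitive`).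

A transversal through the compact leaf at `r = 1` is related to the numbering, for `r < 1`, by the
morphism `h = -f`. Flatness of `1/h'` sends the normalized derivatives `h⁽ᵖ⁾/h'ᵖ`, `p ≥ 2`, to zero,
so the jets of `h` enter the tube as `r → 1`. Along them the pull-back of `θ` is the derivative of
`F + log |h'|`. It is also a component of `γ` in a chart that extends across `r = 1`, hence bounded.
Integrating over a bounded interval, `c h + log |h'|` is bounded. But `h''/h'² → 0` makes `log |h'|`
vary slowly compared with `h`, while `|h|` and `|h'|` tend to infinity: neither `c ≠ 0` nor `c = 0`
is possible (`not_eventually_bounded_add_log_deriv`). -/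

theorem pushFrame_zero (h : ℝ → ℝ) (x : ℕ → ℝ) : pushFrame h x 0 = h (x 0) := by
  simp [pushFrame]

theorem pushFrame_one {h : ℝ → ℝ} {x : ℕ → ℝ} (hd : DifferentiableAt ℝ h (x 0)) :
    pushFrame h x 1 = deriv h (x 0) * x 1 := by
  simp only [pushFrame, iteratedDeriv_one, Finset.sum_range_succ, Finset.sum_range_zero]
  have h1 : HasDerivAt (fun s : ℝ => 0 + x 0 / (0 ! : ℝ) * s ^ 0 + x 1 / (1 ! : ℝ) * s ^ 1)
      (x 1) 0 := by
    simpa using ((hasDerivAt_id (0 : ℝ)).const_mul (x 1)).const_add (x 0)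
  have h2 : HasDerivAt h (deriv h (x 0))
      (0 + x 0 / (0 ! : ℝ) * (0 : ℝ) ^ 0 + x 1 / (1 ! : ℝ) * (0 : ℝ) ^ 1) := by
    simpa using hd.hasDerivAt
  exact (h2.comp (0 : ℝ) h1).deriv

theorem pushFrame_two {h : ℝ → ℝ} {x : ℕ → ℝ} (hd : ContDiffAt ℝ 2 h (x 0)) :
    pushFrame h x 2 = deriv (deriv h) (x 0) * x 1 ^ 2 + deriv h (x 0) * x 2 := by
  have hq : ∀ s : ℝ, HasDerivAt (fun s : ℝ => x 0 + x 1 * s + x 2 / 2 * s ^ 2)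
      (x 1 + x 2 * s) s := by
    intro s
    have := (((hasDerivAt_id s).const_mul (x 1)).const_add (x 0)).add
      (((hasDerivAt_id s).pow 2).const_mul (x 2 / 2))
    refine this.congr_deriv ?_
    simp
    ring
  have hev : ∀ᶠ s in 𝓝 (0 : ℝ), DifferentiableAt ℝ h (x 0 + x 1 * s + x 2 / 2 * s ^ 2) := by
    have hc : Tendsto (fun s : ℝ => x 0 + x 1 * s + x 2 / 2 * s ^ 2) (𝓝 0) (𝓝 (x 0)) := by
      simpa using (hq 0).continuousAt.tendsto
    exact hc.eventually ((hd.eventually (by simp)).mono fun a ha => ha.differentiableAt (by simp))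
  have h1 : deriv (fun s : ℝ => h (x 0 + x 1 * s + x 2 / 2 * s ^ 2)) =ᶠ[𝓝 0]
      fun s => deriv h (x 0 + x 1 * s + x 2 / 2 * s ^ 2) * (x 1 + x 2 * s) := by
    filter_upwards [hev] with s hs
    exact (hs.hasDerivAt.comp s (hq s)).deriv
  have hd2 : DifferentiableAt ℝ (deriv h) (x 0) :=
    (hd.derivWithin (m := 1) (by norm_num)).differentiableAt (by simp)
  have h2 : HasDerivAt (deriv h) (deriv (deriv h) (x 0))
      (x 0 + x 1 * (0 : ℝ) + x 2 / 2 * (0 : ℝ) ^ 2) := by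
    simpa using hd2.hasDerivAt
  have h3 := (h2.comp (0 : ℝ) (hq 0)).mul (((hasDerivAt_id (0 : ℝ)).const_mul (x 2)).const_add (x 1))
  have e : (fun s : ℝ => h (∑ i ∈ Finset.range (2 + 1), x i / (i ! : ℝ) * s ^ i)) =
      fun s => h (x 0 + x 1 * s + x 2 / 2 * s ^ 2) := by
    funext s
    simp [Finset.sum_range_succ]
  rw [pushFrame, e, iteratedDeriv_succ, iteratedDeriv_one, h1.deriv_eq]
  refine h3.deriv.trans ?_
  simp
  ring

theorem pushJet_idx0 (h : ℝ → ℝ) (y : JetSpace) : pushJet h y idx0 = h (y idx0) := by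
  simp [pushJet, reduceFrame, pushFrame_zero, liftFrame]

theorem pushJet_idx2 {h : ℝ → ℝ} {y : JetSpace} (hd : ContDiffAt ℝ 2 h (y idx0)) :
    pushJet h y idx2 =
      (deriv (deriv h) (y idx0) + deriv h (y idx0) * y idx2) / deriv h (y idx0) ^ 2 := by
  have h0 : liftFrame y 0 = y idx0 := by simp [liftFrame]
  have h1 : liftFrame y 1 = 1 := by simp [liftFrame]
  have h2 : liftFrame y 2 = y idx2 := by simp [liftFrame]
  have hd' : ContDiffAt ℝ 2 h (liftFrame y 0) := by rwa [h0]
  simp only [pushJet, reduceFrame]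
  rw [pushFrame_one (hd'.differentiableAt (by simp)), pushFrame_two hd', h0, h1, h2]
  simp

theorem pushJetDeriv_idx0 {h : ℝ → ℝ} {y : JetSpace} (hd : DifferentiableAt ℝ h (y idx0))
    (v : JetSpace) : pushJetDeriv h y v idx0 = deriv h (y idx0) * v idx0 := by
  simp only [pushJetDeriv, pushJet_idx0, lineDeriv]
  have h1 : HasDerivAt (fun t : ℝ => (y + t • v) idx0) (v idx0) 0 := by
    simpa using ((hasDerivAt_id (0 : ℝ)).mul_const (v idx0)).const_add (y idx0)
  have h2 : HasDerivAt h (deriv h (y idx0)) ((y + (0 : ℝ) • v) idx0) := by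
    simpa using hd.hasDerivAt
  exact (h2.comp (0 : ℝ) h1).deriv

/-- The coefficient `c` can stay unspecified: it multiplies `v idx0`, so its contribution disappears
in a wedge product with `dy₀`. -/
theorem pushJetDeriv_idx2 {h : ℝ → ℝ} {y : JetSpace} (hd : ContDiffAt ℝ 3 h (y idx0))
    (hne : deriv h (y idx0) ≠ 0) :
    ∃ c, ∀ v, pushJetDeriv h y v idx2 = c * v idx0 + v idx2 / deriv h (y idx0) := by
  refine ⟨((deriv (deriv (deriv h)) (y idx0) + deriv (deriv h) (y idx0) * y idx2) *
      deriv h (y idx0) ^ 2 - (deriv (deriv h) (y idx0) + deriv h (y idx0) * y idx2) *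
      (2 * deriv h (y idx0) * deriv (deriv h) (y idx0))) / (deriv h (y idx0) ^ 2) ^ 2, fun v => ?_⟩
  have h1 : HasDerivAt (fun t : ℝ => (y + t • v) idx0) (v idx0) 0 := by
    simpa using ((hasDerivAt_id (0 : ℝ)).mul_const (v idx0)).const_add (y idx0)
  have h1' : HasDerivAt (fun t : ℝ => (y + t • v) idx2) (v idx2) 0 := by
    simpa using ((hasDerivAt_id (0 : ℝ)).mul_const (v idx2)).const_add (y idx2)
  have hz : (y + (0 : ℝ) • v) = y := by simp
  have hd1 : ContDiffAt ℝ 2 (deriv h) (y idx0) := hd.derivWithin (by norm_num)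
  have hd2 : ContDiffAt ℝ 1 (deriv (deriv h)) (y idx0) := hd1.derivWithin (by norm_num)
  have hev : (fun t : ℝ => pushJet h (y + t • v) idx2) =ᶠ[𝓝 0] fun t =>
      (deriv (deriv h) ((y + t • v) idx0) + deriv h ((y + t • v) idx0) * (y + t • v) idx2) /
        deriv h ((y + t • v) idx0) ^ 2 := by
    have hc : Tendsto (fun t : ℝ => (y + t • v) idx0) (𝓝 0) (𝓝 (y idx0)) := by
      simpa using h1.continuousAt.tendsto
    filter_upwards [hc.eventually (hd.eventually (by simp))] with t ht
    exact pushJet_idx2 (ht.of_le (by norm_num))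
  have k1 : HasDerivAt (deriv h) (deriv (deriv h) (y idx0)) ((y + (0 : ℝ) • v) idx0) := by
    rw [hz]; exact (hd1.differentiableAt (by simp)).hasDerivAt
  have k2 : HasDerivAt (deriv (deriv h)) (deriv (deriv (deriv h)) (y idx0))
      ((y + (0 : ℝ) • v) idx0) := by
    rw [hz]; exact (hd2.differentiableAt (by simp)).hasDerivAt
  have c1 := k1.comp (0 : ℝ) h1
  have c2 := k2.comp (0 : ℝ) h1
  have := ((c2.add (c1.mul h1')).div (c1.pow 2) (by simpa using hne))
  have e := this.deriv
  simp only [pushJetDeriv, lineDeriv]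
  rw [hev.deriv_eq]
  refine e.trans ?_
  simp
  field_simp
  ring

theorem IsChartMorphism.contDiffAt {X : Type*} {k₁ k₂ : LineChart X} {h : ℝ → ℝ}
    (hh : IsChartMorphism k₁ k₂ h) {u : ℝ} (hu : u ∈ k₁.dom) : ContDiffAt ℝ ∞ h u :=
  hh.smooth.contDiffAt (k₁.dom.isOpen.mem_nhds hu)

/-- A morphism multiplies `dy₀` by `h'` and, modulo `dy₀`, divides `dy₂` by `h'`. The invariance
thus holds for every set of charts. -/
theorem isFrameForm_firstChernForm {X : Type*} (Φ : Set (LineChart X)) :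
    IsFrameForm Φ 2 (firstChernForm X) where
  smooth := by
    intro k _ y _
    refine ⟨{idx0, idx2}, fun _ => dy2_wedge_dy0.compContinuousLinearMap
      ((ContinuousLinearMap.pi fun p : JetIdx =>
        if hp : p ∈ ({idx0, idx2} : Finset JetIdx) then ContinuousLinearMap.proj ⟨p, hp⟩ else 0)),
      Eventually.of_forall fun _ => contDiffAt_const, Eventually.of_forall fun z => ?_⟩
    ext v
    change v 0 idx2 * v 1 idx0 - v 0 idx0 * v 1 idx2 = _ * _ - _ * _
    rfl
  compat := by
    intro k₁ _ k₂ _ h hh y hy v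
    have hs := hh.contDiffAt (u := y idx0) hy
    have hne := hh.etale (y idx0) hy
    have hs1 : DifferentiableAt ℝ h (y idx0) := hs.differentiableAt (by simp)
    have hs3 : ContDiffAt ℝ 3 h (y idx0) := by
      exact_mod_cast contDiffAt_infty.1 hs 3
    obtain ⟨c, hc⟩ := pushJetDeriv_idx2 hs3 hne
    change v 0 idx2 * v 1 idx0 - v 0 idx0 * v 1 idx2 = _ * _ - _ * _
    simp only [hc, pushJetDeriv_idx0 hs1]
    field_simp
    ring

theorem isClosedFrameForm_firstChernForm {X : Type*} (Φ : Set (LineChart X)) :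
    IsClosedFrameForm Φ (firstChernForm X) := by
  intro k _ y _ v
  simp [formDeriv, firstChernForm, lineDeriv]

/-! ### One-dimensional manifolds -/

/-- The 1-form `(y₂ + G y₀) dy₀`. -/
noncomputable def connectionForm (G : ℝ → ℝ) (y : JetSpace) : JetSpace [⋀^Fin 1]→L[ℝ] ℝ :=
  (y idx2 + G (y idx0)) •
    ContinuousAlternatingMap.ofSubsingleton ℝ JetSpace ℝ (0 : Fin 1)
      (ContinuousLinearMap.proj idx0 : JetSpace →L[ℝ] ℝ)

theorem connectionForm_apply (G : ℝ → ℝ) (y : JetSpace) (v : Fin 1 → JetSpace) :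
    connectionForm G y v = (y idx2 + G (y idx0)) * v 0 idx0 := by
  simp [connectionForm]

theorem isSmoothForm_connectionForm {U : Set ℝ} (hU : IsOpen U) {G : ℝ → ℝ}
    (hG : ContDiffOn ℝ ∞ G U) : IsSmoothForm (jetDomain U) (connectionForm G) := by
  intro y hy
  let a0 : ({idx0, idx2} : Finset JetIdx) := ⟨idx0, by simp⟩
  let a2 : ({idx0, idx2} : Finset JetIdx) := ⟨idx2, by simp⟩
  refine ⟨{idx0, idx2}, fun a => (a a2 + G (a a0)) •
    ContinuousAlternatingMap.ofSubsingleton ℝ _ ℝ (0 : Fin 1)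
      (ContinuousLinearMap.proj a0 : (({idx0, idx2} : Finset JetIdx) → ℝ) →L[ℝ] ℝ), ?_, ?_⟩
  · have ho : IsOpen {a : ({idx0, idx2} : Finset JetIdx) → ℝ | a a0 ∈ U} :=
      hU.preimage (continuous_apply a0)
    filter_upwards [ho.mem_nhds (show restrictCoords _ y ∈ _ from hy)] with a ha
    have h0 : ContDiffAt ℝ ∞ (fun a : ({idx0, idx2} : Finset JetIdx) → ℝ => a a0) a :=
      (contDiff_apply ℝ ℝ a0).contDiffAt
    have h2 : ContDiffAt ℝ ∞ (fun a : ({idx0, idx2} : Finset JetIdx) → ℝ => a a2) a :=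
      (contDiff_apply ℝ ℝ a2).contDiffAt
    have h3 := (hG.contDiffAt (hU.mem_nhds ha)).comp a h0
    exact (h2.add h3).smul contDiffAt_const
  · refine Eventually.of_forall fun z => ?_
    ext v
    simp [connectionForm_apply, restrictCoords, a0, a2]

/-- The differential of `G(y₀)` is a multiple of `dy₀`, so the term in `G` contributes nothing. -/
theorem formDeriv_connectionForm {G : ℝ → ℝ} {y : JetSpace}
    (hG : DifferentiableAt ℝ G (y idx0)) (v : Fin 2 → JetSpace) :
    formDeriv (connectionForm G) y v = dy2_wedge_dy0 v := by
  have key : ∀ v w : JetSpace,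
      lineDeriv ℝ (fun z : JetSpace => (z idx2 + G (z idx0)) * w idx0) y v =
        (v idx2 + deriv G (y idx0) * v idx0) * w idx0 := by
    intro v w
    have h0 : HasDerivAt (fun t : ℝ => (y + t • v) idx0) (v idx0) 0 := by
      simpa using ((hasDerivAt_id (0 : ℝ)).mul_const (v idx0)).const_add (y idx0)
    have h2 : HasDerivAt (fun t : ℝ => (y + t • v) idx2) (v idx2) 0 := by
      simpa using ((hasDerivAt_id (0 : ℝ)).mul_const (v idx2)).const_add (y idx2)
    have h1 : HasDerivAt G (deriv G (y idx0)) ((y + (0 : ℝ) • v) idx0) := by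
      simpa using hG.hasDerivAt
    exact ((h2.add (h1.comp (0 : ℝ) h0)).mul_const (w idx0)).deriv
  simp only [formDeriv, connectionForm_apply, key]
  change _ = v 0 idx2 * v 1 idx0 - v 0 idx0 * v 1 idx2
  simp [Fin.removeNth]
  ring

/-- A family of functions on the domains of charts that transforms like the Christoffel symbols
of a connection makes the first Chern form exact. -/
theorem isExactFrameForm_of_connection {X : Type*} (Φ : Set (LineChart X))
    (G : LineChart X → ℝ → ℝ) (hG : ∀ k ∈ Φ, ContDiffOn ℝ ∞ (G k) k.dom)
    (hcomp : ∀ k₁ ∈ Φ, ∀ k₂ ∈ Φ, ∀ h : ℝ → ℝ, IsChartMorphism k₁ k₂ h → ∀ u ∈ k₁.dom,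
      G k₁ u = deriv (deriv h) u / deriv h u + G k₂ (h u) * deriv h u) :
    IsExactFrameForm Φ (firstChernForm X) := by
  refine ⟨fun k => connectionForm (G k), ⟨fun k hk =>
    isSmoothForm_connectionForm k.dom.isOpen (hG k hk), ?_⟩, ?_⟩
  -- The summand `h''/h'` gained by `y₂` is exactly the inhomogeneous term in the transformation
  -- rule of `G`.
  · intro k₁ hk₁ k₂ hk₂ h hh y hy v
    have hs := hh.contDiffAt (u := y idx0) hy
    have hne := hh.etale (y idx0) hy
    have hs2 : ContDiffAt ℝ 2 h (y idx0) := by exact_mod_cast contDiffAt_infty.1 hs 2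
    rw [connectionForm_apply, connectionForm_apply, pushJet_idx0, pushJet_idx2 hs2,
      pushJetDeriv_idx0 (hs.differentiableAt (by simp)), hcomp k₁ hk₁ k₂ hk₂ h hh _ hy]
    field_simp
    ring
  · intro k hk y hy v
    exact formDeriv_connectionForm
      (((hG k hk).contDiffAt (k.dom.isOpen.mem_nhds hy)).differentiableAt (by simp)) v

/-! ### Functions on `X` read in a chart -/

namespace LineChart

/-- The function `F ∘ k` on the domain of the chart `k`, extended by zero to the line. -/
noncomputable def pullFun {X : Type*} (k : LineChart X) (F : X → ℝ) : ℝ → ℝ := by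
  classical exact fun u => if hu : u ∈ k.dom then F (k.toFun ⟨u, hu⟩) else 0

theorem pullFun_apply {X : Type*} (k : LineChart X) (F : X → ℝ) {u : ℝ} (hu : u ∈ k.dom) :
    k.pullFun F u = F (k.toFun ⟨u, hu⟩) := by
  simp [pullFun, hu]

theorem pullFun_comp {X : Type*} {k₁ k₂ : LineChart X} {h : ℝ → ℝ} (hh : IsChartMorphism k₁ k₂ h)
    (F : X → ℝ) {u : ℝ} (hu : u ∈ k₁.dom) : k₁.pullFun F u = k₂.pullFun F (h u) := by
  obtain ⟨hv, e⟩ := hh.comp u hu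
  rw [pullFun_apply k₁ F hu, pullFun_apply k₂ F hv, e]

theorem contDiffAt_pullFun {X : Type*} {k : LineChart X} {F : X → ℝ} {u : ℝ} (hu : u ∈ k.dom)
    (hF : ContMDiffAt 𝓘(ℝ, ℝ) 𝓘(ℝ, ℝ) ∞ (F ∘ k.toFun) ⟨u, hu⟩) :
    ContDiffAt ℝ ∞ (k.pullFun F) u := by
  rw [← contMDiffAt_iff_contDiffAt]
  refine (contMDiffAt_subtype_iff (U := k.dom) (x := ⟨u, hu⟩)).1 ?_
  refine hF.congr_of_eventuallyEq (Eventually.of_forall fun x => ?_)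
  exact pullFun_apply k F x.2

/-- A smooth local inverse composed with the function is the identity near `u`; by the chain rule
the derivative is a factor of `1`. -/
theorem deriv_pullFun_ne_zero {M : Type*} [TopologicalSpace M] [ChartedSpace ℝ M]
    {k : LineChart M} {F : M → ℝ} {u : ℝ} (hu : u ∈ k.dom)
    (hF : IsLocalDiffeomorphAt 𝓘(ℝ, ℝ) 𝓘(ℝ, ℝ) ∞ (F ∘ k.toFun) ⟨u, hu⟩) :
    deriv (k.pullFun F) u ≠ 0 := by
  have hd : DifferentiableAt ℝ (k.pullFun F) u :=
    (contDiffAt_pullFun hu hF.contMDiffAt).differentiableAt (by simp)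
  have hval : ContMDiff 𝓘(ℝ, ℝ) 𝓘(ℝ, ℝ) ∞ (Subtype.val : k.dom → ℝ) := contMDiff_subtype_val
  have hg : ContMDiffAt 𝓘(ℝ, ℝ) 𝓘(ℝ, ℝ) ∞ (Subtype.val ∘ hF.localInverse)
      ((F ∘ k.toFun) ⟨u, hu⟩) :=
    hval.contMDiffAt.comp _ hF.localInverse_contMDiffAt
  rw [contMDiffAt_iff_contDiffAt] at hg
  have hg' : DifferentiableAt ℝ (Subtype.val ∘ hF.localInverse) (k.pullFun F u) := by
    rw [pullFun_apply k F hu]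
    exact hg.differentiableAt (by simp)
  have hc := hg'.hasDerivAt.comp u hd.hasDerivAt
  have hid : ((Subtype.val ∘ hF.localInverse) ∘ k.pullFun F) =ᶠ[𝓝 u] id := by
    have h1 := hF.localInverse_eventuallyEq_left
    -- The identity holds near `u` in the subtype; the open embedding of the domain carries it to a
    -- neighbourhood in the line.
    have h2 : ∀ᶠ x in 𝓝 u, ∀ hx : x ∈ k.dom,
        (hF.localInverse ∘ (F ∘ k.toFun)) ⟨x, hx⟩ = ⟨x, hx⟩ := by
      have := (k.dom.isOpen.isOpenEmbedding_subtypeVal.map_nhds_eq ⟨u, hu⟩)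
      change Filter.map _ _ = 𝓝 u at this
      rw [← this, Filter.eventually_map]
      filter_upwards [h1] with x hx _
      exact hx
    filter_upwards [h2, k.dom.isOpen.mem_nhds hu] with x hx hxd
    have := congrArg Subtype.val (hx hxd)
    simp only [Function.comp] at this ⊢
    rw [pullFun_apply k F hxd]
    exact this
  have h1 := hc.deriv
  rw [hid.deriv_eq, deriv_id] at h1
  intro h0
  rw [h0, mul_zero] at h1
  exact one_ne_zero h1

end LineChart

/-! ### Averaging flat connections on a manifold of dimension one -/

section Manifold

variable {M : Type*} [TopologicalSpace M] [ChartedSpace ℝ M] [IsManifold 𝓘(ℝ, ℝ) ∞ M]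

theorem isLocalDiffeomorphAt_chartAt (i x : M) (hx : x ∈ (chartAt ℝ i).source) :
    IsLocalDiffeomorphAt 𝓘(ℝ, ℝ) 𝓘(ℝ, ℝ) ∞ (chartAt ℝ i) x :=
  ⟨{ toPartialEquiv := (chartAt ℝ i).toPartialEquiv
     open_source := (chartAt ℝ i).open_source
     open_target := (chartAt ℝ i).open_target
     contMDiffOn_toFun := contMDiffOn_chart
     contMDiffOn_invFun := contMDiffOn_chart_symm }, hx, fun _ _ => rfl⟩

/-- The ratio of the second to the first derivative. -/
noncomputable def preSchwarzian (F : ℝ → ℝ) (u : ℝ) : ℝ := deriv (deriv F) u / deriv F u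

/-- Take the logarithmic derivative of `(F ∘ h)' = (F' ∘ h) h'`. This is the Christoffel rule, so
`F''/F'` is the symbol of the flat connection with affine coordinate `F`. -/
theorem preSchwarzian_comp {F h : ℝ → ℝ} {u : ℝ} (hF : ContDiffAt ℝ 2 F (h u))
    (hh : ContDiffAt ℝ 2 h u) (hF0 : deriv F (h u) ≠ 0) (hh0 : deriv h u ≠ 0) :
    preSchwarzian (F ∘ h) u = preSchwarzian h u + preSchwarzian F (h u) * deriv h u := by
  have h1 : deriv (F ∘ h) =ᶠ[𝓝 u] fun x => deriv F (h x) * deriv h x := by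
    filter_upwards [hh.continuousAt.eventually (hF.eventually (by simp)),
      hh.eventually (by simp)] with x hx hx'
    exact ((hx.differentiableAt (by simp)).hasDerivAt.comp x
      (hx'.differentiableAt (by simp)).hasDerivAt).deriv
  have hF1 : DifferentiableAt ℝ (deriv F) (h u) :=
    (hF.derivWithin (m := 1) (by norm_num)).differentiableAt (by simp)
  have hh1 : DifferentiableAt ℝ (deriv h) u :=
    (hh.derivWithin (m := 1) (by norm_num)).differentiableAt (by simp)
  have hhd : DifferentiableAt ℝ h u := hh.differentiableAt (by simp)
  have h2 := (hF1.hasDerivAt.comp u hhd.hasDerivAt).mul hh1.hasDerivAt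
  have h3 : deriv (deriv (F ∘ h)) u =
      deriv (deriv F) (h u) * deriv h u * deriv h u + deriv F (h u) * deriv (deriv h) u := by
    rw [h1.deriv_eq]
    exact h2.deriv
  rw [preSchwarzian, h3, h1.eq_of_nhds, preSchwarzian, preSchwarzian]
  field_simp
  ring

theorem contDiffAt_preSchwarzian {F : ℝ → ℝ} {u : ℝ} (hF : ContDiffAt ℝ ∞ F u)
    (hF0 : deriv F u ≠ 0) : ContDiffAt ℝ ∞ (preSchwarzian F) u := by
  have h1 : ContDiffAt ℝ ∞ (deriv F) u := hF.derivWithin (by simp)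
  have h2 : ContDiffAt ℝ ∞ (deriv (deriv F)) u := h1.derivWithin (by simp)
  exact h2.div h1 hF0

/-- The Christoffel symbol, in the chart `k`, of the connection that averages the flat connections
of the charts of an atlas with the weights `ρ`. -/
noncomputable def averageConnection (ρ : SmoothPartitionOfUnity M 𝓘(ℝ, ℝ) M univ)
    (k : LineChart M) (u : ℝ) : ℝ :=
  ∑ᶠ i, k.pullFun (ρ i) u * preSchwarzian (k.pullFun (chartAt ℝ i)) u

/-- Local finiteness leaves a finite sum near each point. Subordination places the point in the
source of every chart that occurs, so the chart reads there as a function with non-zero derivative.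
-/
theorem contDiffOn_averageConnection {ρ : SmoothPartitionOfUnity M 𝓘(ℝ, ℝ) M univ}
    (hρ : ρ.IsSubordinate fun x => (chartAt ℝ x).source)
    {k : LineChart M} (hk : k ∈ manifoldCharts M) :
    ContDiffOn ℝ ∞ (averageConnection ρ k) k.dom := by
  intro u hu
  refine ContDiffAt.contDiffWithinAt ?_
  have hk' : IsLocalDiffeomorph 𝓘(ℝ, ℝ) 𝓘(ℝ, ℝ) ∞ k.toFun := hk
  have hcont : ContinuousAt k.toFun ⟨u, hu⟩ := (hk' ⟨u, hu⟩).contMDiffAt.continuousAt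
  -- The closed supports through the point control the non-zero weights at all nearby points; the
  -- open supports would not.
  have hev : averageConnection ρ k =ᶠ[𝓝 u] fun x => ∑ i ∈ ρ.fintsupport (k.toFun ⟨u, hu⟩),
      k.pullFun (ρ i) x * preSchwarzian (k.pullFun (chartAt ℝ i)) x := by
    have := (k.dom.isOpen.isOpenEmbedding_subtypeVal.map_nhds_eq ⟨u, hu⟩)
    change Filter.map _ _ = 𝓝 u at this
    rw [← this, EventuallyEq, Filter.eventually_map]
    filter_upwards [hcont.eventually (ρ.eventually_fintsupport_subset _)] with x hx
    refine finsum_eq_sum_of_support_subset _ fun i hi => ?_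
    refine hx (ρ.finsupport_subset_fintsupport _ ?_)
    rw [SmoothPartitionOfUnity.mem_finsupport]
    intro h0
    refine hi ?_
    have h1 : k.pullFun (ρ i) x = 0 := (LineChart.pullFun_apply k _ x.2).trans h0
    simp only [h1, zero_mul]
  refine ContDiffAt.congr_of_eventuallyEq ?_ hev
  refine ContDiffAt.sum fun i hi => ?_
  rw [SmoothPartitionOfUnity.mem_fintsupport_iff] at hi
  have hl := IsLocalDiffeomorphAt.comp (K := 𝓘(ℝ, ℝ)) (hf := hk' ⟨u, hu⟩)
    (hg := isLocalDiffeomorphAt_chartAt i _ (hρ i hi))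
  exact (LineChart.contDiffAt_pullFun hu
      ((ρ i).contMDiff.contMDiffAt.comp _ (hk' ⟨u, hu⟩).contMDiffAt)).mul
    (contDiffAt_preSchwarzian (LineChart.contDiffAt_pullFun hu hl.contMDiffAt)
      (LineChart.deriv_pullFun_ne_zero hu hl))

/-- Every flat connection obeys the rule with the same inhomogeneous term `h''/h'`, and the weights
sum to `1`; affine combinations preserve the rule. -/
theorem averageConnection_comp {ρ : SmoothPartitionOfUnity M 𝓘(ℝ, ℝ) M univ}
    (hρ : ρ.IsSubordinate fun x => (chartAt ℝ x).source)
    {k₁ k₂ : LineChart M} (hk₂ : k₂ ∈ manifoldCharts M) {h : ℝ → ℝ}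
    (hh : IsChartMorphism k₁ k₂ h) {u : ℝ} (hu : u ∈ k₁.dom) :
    averageConnection ρ k₁ u = preSchwarzian h u + averageConnection ρ k₂ (h u) * deriv h u := by
  obtain ⟨hv, e⟩ := hh.comp u hu
  have hk' : IsLocalDiffeomorph 𝓘(ℝ, ℝ) 𝓘(ℝ, ℝ) ∞ k₂.toFun := hk₂
  set x := k₂.toFun ⟨h u, hv⟩ with hx
  have hR : ∀ i, k₂.pullFun (ρ i) (h u) = ρ i x := fun i => LineChart.pullFun_apply _ _ hv
  have hsum : ∀ T : M → ℝ, ∑ᶠ i, ρ i x * T i = ∑ i ∈ ρ.finsupport x, ρ i x * T i := by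
    intro T
    refine finsum_eq_sum_of_support_subset _ fun i hi => ?_
    rw [SmoothPartitionOfUnity.coe_finsupport]
    exact left_ne_zero_of_mul hi
  have hone : ∑ i ∈ ρ.finsupport x, ρ i x = 1 := ρ.sum_finsupport x (mem_univ x)
  simp only [averageConnection, LineChart.pullFun_comp hh _ hu, hR, hsum]
  -- The inhomogeneous term is spread over the indices by writing `1` as the sum of the weights.
  rw [Finset.sum_mul, ← one_mul (preSchwarzian h u), ← hone, Finset.sum_mul,
    ← Finset.sum_add_distrib]
  refine Finset.sum_congr rfl fun i hi => ?_
  rw [SmoothPartitionOfUnity.mem_finsupport] at hi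
  have hl := IsLocalDiffeomorphAt.comp (K := 𝓘(ℝ, ℝ)) (hf := hk' ⟨h u, hv⟩)
    (hg := isLocalDiffeomorphAt_chartAt i _ (hρ i (subset_tsupport _ hi)))
  have hev : k₁.pullFun (chartAt ℝ i) =ᶠ[𝓝 u] k₂.pullFun (chartAt ℝ i) ∘ h := by
    filter_upwards [k₁.dom.isOpen.mem_nhds hu] with z hz
    exact LineChart.pullFun_comp hh _ hz
  have hT : preSchwarzian (k₁.pullFun (chartAt ℝ i)) u =
      preSchwarzian (k₂.pullFun (chartAt ℝ i) ∘ h) u := by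
    rw [preSchwarzian, preSchwarzian, hev.deriv_eq, hev.deriv.deriv_eq]
  have hF := LineChart.contDiffAt_pullFun hv hl.contMDiffAt
  rw [hT, preSchwarzian_comp (by exact_mod_cast contDiffAt_infty.1 hF 2)
    (by exact_mod_cast contDiffAt_infty.1 (hh.contDiffAt hu) 2)
    (LineChart.deriv_pullFun_ne_zero hv hl) (hh.etale u hu)]
  ring

variable (M) in
theorem isExactFrameForm_manifoldCharts [T2Space M] [SecondCountableTopology M] :
    IsExactFrameForm (manifoldCharts M) (firstChernForm M) := by
  have : LocallyCompactSpace M := ChartedSpace.locallyCompactSpace ℝ M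
  have : SigmaCompactSpace M := sigmaCompactSpace_of_locallyCompact_secondCountable
  obtain ⟨ρ, hρ⟩ := SmoothPartitionOfUnity.exists_isSubordinate_chartAt_source 𝓘(ℝ, ℝ) M
  exact isExactFrameForm_of_connection _ (averageConnection ρ)
    (fun k hk => contDiffOn_averageConnection hρ hk)
    fun k₁ _ k₂ hk₂ h hh u hu => averageConnection_comp hρ hk₂ hh hu

end Manifold

/-! ### Translations, and the jets of a function along the line -/

/-- The coordinate vector of `y₀`. -/
noncomputable def e₀ : JetSpace := Pi.single idx0 1

@[simp] theorem e₀_idx0 : e₀ idx0 = 1 := by simp [e₀]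

theorem e₀_apply {p : JetIdx} (hp : p ≠ idx0) : e₀ p = 0 := by simp [e₀, hp]

theorem pushFrame_add_const (c : ℝ) (x : ℕ → ℝ) (p : ℕ) :
    pushFrame (fun s => s + c) x p = x p + if p = 0 then c else 0 := by
  have hp : (p ! : ℝ) ≠ 0 := by positivity
  simp (disch := fun_prop) only [pushFrame, iteratedDeriv_fun_add, iteratedDeriv_const,
    iteratedDeriv_fun_sum, iteratedDeriv_const_mul, iteratedDeriv_fun_pow_zero]
  rw [Finset.sum_eq_single p]
  · simp
    field_simp
  · intro b _ hb
    simp [hb.symm]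
  · simp

/-- Needed for `c = 1`, the renumbering of the leaves, and for `c = 0`, the inclusion of one chart
domain in another. -/
theorem pushJet_add_const (c : ℝ) (y : JetSpace) :
    pushJet (fun s => s + c) y = y + c • e₀ := by
  funext p
  have h1 : liftFrame y 1 = 1 := by simp [liftFrame]
  have hp : liftFrame y p = y p := by simp [liftFrame, p.2]
  simp only [pushJet, reduceFrame, pushFrame_add_const, h1, hp]
  by_cases h : p = idx0
  · subst h; simp
  · have h' : (p : ℕ) ≠ 0 := fun h0 => h (Subtype.ext h0)
    simp [h', e₀_apply h]

theorem pushJetDeriv_add_const (c : ℝ) (y v : JetSpace) :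
    pushJetDeriv (fun s => s + c) y v = v := by
  funext j
  simp only [pushJetDeriv, pushJet_add_const, lineDeriv]
  have : HasDerivAt (fun t : ℝ => (y + t • v + c • e₀) j) (v j) 0 := by
    simpa using (((hasDerivAt_id (0 : ℝ)).mul_const (v j)).const_add (y j)).add_const (c • e₀ j)
  exact this.deriv

/-- The point `r • e₀` is the jet of `s ↦ r + s`, whose Taylor polynomials of positive degree are
exact, so no smoothness of `h` is needed. -/
theorem pushJet_smul_e₀ (h : ℝ → ℝ) (r : ℝ) (j : JetIdx) :
    pushJet h (r • e₀) j = iteratedDeriv j h r / deriv h r ^ (j : ℕ) := by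
  have key : ∀ p : ℕ, pushFrame h (liftFrame (r • e₀)) p = iteratedDeriv p h r := by
    intro p
    have h0 : liftFrame (r • e₀) 0 = r := by simp [liftFrame]
    have h1 : liftFrame (r • e₀) 1 = 1 := by simp [liftFrame]
    have h2 : ∀ i, 1 < i → liftFrame (r • e₀) i = 0 := by
      intro i hi
      have : (⟨i, by omega⟩ : JetIdx) ≠ idx0 := by simp; omega
      simp [liftFrame, hi.ne', e₀_apply this]
    rcases Nat.eq_zero_or_pos p with rfl | hp
    · simp [pushFrame_zero, h0]
    · have e : (fun s => h (∑ i ∈ Finset.range (p + 1), liftFrame (r • e₀) i / (i ! : ℝ) * s ^ i)) =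
          fun s => h (r + s) := by
        funext s
        congr 1
        rw [← Finset.sum_subset (s₁ := Finset.range 2)
          (fun i hi => by simp at hi ⊢; omega)
          (fun i _ hi => by rw [h2 i (by simp at hi; omega)]; simp)]
        simp [Finset.sum_range_succ, h0, h1]
      rw [pushFrame, e, iteratedDeriv_comp_const_add]
      simp
  simp only [pushJet, reduceFrame, key, iteratedDeriv_one]

theorem pushJetDeriv_smul_e₀ (h : ℝ → ℝ) (r : ℝ) (j : JetIdx) :
    pushJetDeriv h (r • e₀) e₀ j =
      deriv (fun x => iteratedDeriv j h x / deriv h x ^ (j : ℕ)) r := by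
  simp only [pushJetDeriv, lineDeriv, ← add_smul, pushJet_smul_e₀]
  have := deriv_comp_const_add (fun x => iteratedDeriv j h x / deriv h x ^ (j : ℕ)) r 0
  simpa using this

/-! ### One-forms that depend on finitely many coordinates -/

/-- Near the points with the same coordinates in `s` as `z`, the 1-form `θ` is the pull-back of a
smooth form in the coordinates in `s`. -/
def IsCylindricalAt (θ : JetSpace → JetSpace [⋀^Fin 1]→L[ℝ] ℝ) (s : Finset JetIdx)
    (z : JetSpace) : Prop :=
  ∃ η : (s → ℝ) → (s → ℝ) →L[ℝ] ℝ, ContDiffAt ℝ ∞ η (restrictCoords s z) ∧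
    ∀ᶠ a in 𝓝 (restrictCoords s z), ∀ w, restrictCoords s w = a →
      ∀ v, θ w (fun _ => v) = η a (restrictCoords s v)

section OneForms

variable {θ : JetSpace → JetSpace [⋀^Fin 1]→L[ℝ] ℝ}

/-- Forgetting coordinates. -/
def forgetCoords {s t : Finset JetIdx} (h : s ⊆ t) : (t → ℝ) →L[ℝ] (s → ℝ) :=
  ContinuousLinearMap.pi fun i : s => ContinuousLinearMap.proj (⟨i, h i.2⟩ : t)

theorem IsCylindricalAt.mono {s t : Finset JetIdx} (h : s ⊆ t) {z : JetSpace}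
    (hz : IsCylindricalAt θ s z) : IsCylindricalAt θ t z := by
  obtain ⟨η, h1, h2⟩ := hz
  refine ⟨fun a => (η (forgetCoords h a)).comp (forgetCoords h), ?_, ?_⟩
  · have h3 : ContDiffAt ℝ ∞ (fun a => η (forgetCoords h a)) (restrictCoords t z) :=
      ContDiffAt.comp (restrictCoords t z) h1 (forgetCoords h).contDiff.contDiffAt
    exact h3.clm_comp contDiffAt_const
  · have hc : Tendsto (forgetCoords h) (𝓝 (restrictCoords t z)) (𝓝 (restrictCoords s z)) :=
      (forgetCoords h).continuous.tendsto _
    filter_upwards [hc.eventually h2] with a ha w hw v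
    exact ha w (by rw [← hw]; rfl) v

theorem IsCylindricalAt.translate {s : Finset JetIdx} {z b : JetSpace}
    (hθ : ∀ w, θ (w + b) = θ w) (hz : IsCylindricalAt θ s z) : IsCylindricalAt θ s (z + b) := by
  obtain ⟨η, h1, h2⟩ := hz
  have e : restrictCoords s (z + b) - restrictCoords s b = restrictCoords s z := by simp
  refine ⟨fun a => η (a - restrictCoords s b), ?_, ?_⟩
  · refine ContDiffAt.comp (restrictCoords s (z + b)) (by rwa [e]) ?_
    exact contDiffAt_id.sub contDiffAt_const
  · have hc : Tendsto (fun a => a - restrictCoords s b) (𝓝 (restrictCoords s (z + b)))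
        (𝓝 (restrictCoords s z)) := by
      have : Continuous fun a : s → ℝ => a - restrictCoords s b := by fun_prop
      simpa [e] using this.tendsto (restrictCoords s (z + b))
    filter_upwards [hc.eventually h2] with a ha w hw v
    rw [← ha (w - b) (by rw [map_sub, hw]) v, ← hθ (w - b), sub_add_cancel]

theorem exists_box_subset {N : Set JetSpace} {y : JetSpace} (hN : N ∈ 𝓝 y) :
    ∃ (s : Finset JetIdx) (ε : ℝ), 0 < ε ∧ ∀ z : JetSpace, (∀ p ∈ s, |z p - y p| < ε) → z ∈ N := by
  rw [nhds_pi, Filter.mem_pi'] at hN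
  obtain ⟨s, t, ht, hst⟩ := hN
  have : ∀ p, ∃ ε > 0, Metric.ball (y p) ε ⊆ t p := fun p => Metric.mem_nhds_iff.1 (ht p)
  choose ε hε hb using this
  obtain ⟨δ, hδ, hδε⟩ : ∃ δ > 0, ∀ p ∈ s, δ ≤ ε p := by
    rcases s.eq_empty_or_nonempty with rfl | hs
    · exact ⟨1, one_pos, by simp⟩
    · obtain ⟨p, hp, hmin⟩ := s.exists_min_image ε hs
      exact ⟨ε p, hε p, hmin⟩
  refine ⟨s, δ, hδ, fun z hz => hst fun p hp => hb p ?_⟩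
  rw [Metric.mem_ball, Real.dist_eq]
  exact (hz p hp).trans_le (hδε p hp)

/-- A basic neighbourhood for the product topology constrains finitely many coordinates. Once these
are added to the coordinates used by the form, all others are entirely free. -/
theorem IsSmoothForm.exists_isCylindricalAt {W : Set JetSpace} (hθ : IsSmoothForm W θ)
    {y : JetSpace} (hy : y ∈ W) : ∃ (s : Finset JetIdx) (ε : ℝ), 0 < ε ∧
      ∀ z : JetSpace, (∀ p ∈ s, |z p - y p| < ε) → IsCylindricalAt θ s z := by
  obtain ⟨s, η, h1, h2⟩ := hθ y hy
  obtain ⟨t, ε, hε, hb⟩ :=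
    exists_box_subset (((restrictCoords s).continuous.tendsto y).eventually h1 |>.and h2)
  refine ⟨s ∪ t, ε, hε, fun z hz => ?_⟩
  have hst : s ⊆ s ∪ t := Finset.subset_union_left
  let L := (ContinuousAlternatingMap.ofSubsingleton ℝ (s → ℝ) ℝ (0 : Fin 1)).symm
  have hL : ContDiff ℝ ∞ fun a : (s → ℝ) [⋀^Fin 1]→L[ℝ] ℝ => L a := by
    exact (ContinuousAlternatingMap.ofSubsingletonLIE (𝕜 := ℝ) (E := s → ℝ) (F := ℝ)
      (0 : Fin 1)).symm.contDiff
  refine ⟨fun a => (L (η (forgetCoords hst a))).comp (forgetCoords hst), ?_, ?_⟩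
  · have hz1 := (hb z fun p hp => hz p (Finset.mem_union_right _ hp)).1
    have h3 : ContDiffAt ℝ ∞ (fun a => η (forgetCoords hst a)) (restrictCoords (s ∪ t) z) :=
      ContDiffAt.comp (restrictCoords (s ∪ t) z) hz1 (forgetCoords hst).contDiff.contDiffAt
    exact (hL.contDiffAt.comp _ h3).clm_comp contDiffAt_const
  · have ho : ∀ᶠ a in 𝓝 (restrictCoords (s ∪ t) z), ∀ p : ↥(s ∪ t), |a p - y p| < ε := by
      rw [Filter.eventually_all]
      intro p
      have : Continuous fun a : ↥(s ∪ t) → ℝ => |a p - y p| := by fun_prop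
      exact (this.tendsto _).eventually (gt_mem_nhds (hz p p.2))
    filter_upwards [ho] with a ha w hw v
    subst hw
    have := (hb w fun p hp => ha ⟨p, Finset.mem_union_right _ hp⟩).2
    rw [this]
    rfl

/-- A smooth 1-form on the model space that is periodic in `y₀` depends on finitely many
coordinates only, on a neighbourhood of the line of all points with `y₂ = y₃ = ⋯ = 0`. -/
theorem IsSmoothForm.exists_tube (hθ : IsSmoothForm univ θ) (hper : ∀ y, θ (y + e₀) = θ y) :
    ∃ (s : Finset JetIdx) (ε : ℝ), idx0 ∈ s ∧ idx2 ∈ s ∧ 0 < ε ∧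
      ∀ z : JetSpace, (∀ p ∈ s, p ≠ idx0 → |z p| < ε) → IsCylindricalAt θ s z := by
  -- Index set and radius vary with the point of the line. Over one compact period, finitely many of
  -- them suffice, and unions of index sets and minima of radii give a common choice.
  have hK : ∃ (s : Finset JetIdx) (ε : ℝ), 0 < ε ∧ ∀ z : JetSpace, z idx0 ∈ Icc (0 : ℝ) 1 →
      (∀ p ∈ s, p ≠ idx0 → |z p| < ε) → IsCylindricalAt θ s z := by
    refine (isCompact_Icc (a := (0 : ℝ)) (b := 1)).induction_on (p := fun K =>
      ∃ (s : Finset JetIdx) (ε : ℝ), 0 < ε ∧ ∀ z : JetSpace, z idx0 ∈ K →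
        (∀ p ∈ s, p ≠ idx0 → |z p| < ε) → IsCylindricalAt θ s z) ?_ ?_ ?_ ?_
    · exact ⟨∅, 1, one_pos, fun z hz => hz.elim⟩
    · rintro K K' hKK ⟨s, ε, hε, h⟩
      exact ⟨s, ε, hε, fun z hz => h z (hKK hz)⟩
    · rintro K K' ⟨s, ε, hε, h⟩ ⟨s', ε', hε', h'⟩
      refine ⟨s ∪ s', min ε ε', lt_min hε hε', fun z hz hb => ?_⟩
      rcases hz with hz | hz
      · exact (h z hz fun p hp hp0 => (hb p (Finset.mem_union_left _ hp) hp0).trans_le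
          (min_le_left _ _)).mono Finset.subset_union_left
      · exact (h' z hz fun p hp hp0 => (hb p (Finset.mem_union_right _ hp) hp0).trans_le
          (min_le_right _ _)).mono Finset.subset_union_right
    · intro u _
      obtain ⟨s, ε, hε, h⟩ := hθ.exists_isCylindricalAt (mem_univ (u • e₀))
      refine ⟨Metric.ball u ε, mem_nhdsWithin_of_mem_nhds (Metric.ball_mem_nhds u hε), s, ε, hε,
        fun z hz hb => h z fun p hp => ?_⟩
      by_cases hp0 : p = idx0
      · subst hp0
        simpa [Real.dist_eq] using hz
      · simpa [e₀_apply hp0] using hb p hp hp0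
  obtain ⟨s, ε, hε, h⟩ := hK
  -- The indices `0` and `2` are adjoined so that `y₂ dy₀` also lives on the chosen coordinates.
  refine ⟨insert idx0 (insert idx2 s), ε, by simp, by simp, hε, fun z hz => ?_⟩
  have hper' : Function.Periodic θ e₀ := hper
  have hn : ∀ n : ℤ, ∀ y, θ (y + n • e₀) = θ y := fun n => hper'.zsmul n
  -- Periodicity moves `y₀` into `[0, 1]` by its integer part and then back.
  have h1 : IsCylindricalAt θ s (z + (-⌊z idx0⌋) • e₀) := by
    refine h _ ?_ ?_
    · simp only [Pi.add_apply, Pi.smul_apply, e₀_idx0]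
      constructor
      · simp [Int.floor_le]
      · simpa using by linarith [Int.lt_floor_add_one (z idx0)]
    · intro p hp hp0
      simpa [e₀_apply hp0] using hz p (by simp [hp]) hp0
  have h2 := h1.translate (hn ⌊z idx0⌋)
  rw [neg_smul, neg_add_cancel_right] at h2
  exact h2.mono (by intro p hp; simp [hp])

/-- Near `u` the form comes from finitely many coordinates, so its value along the line is
continuous in `r`. At `u = 1` this is the bound on `γ` across the compact leaf. -/
theorem IsSmoothForm.eventually_bounded {W : Set JetSpace} (hθ : IsSmoothForm W θ) {u : ℝ}
    (hu : u • e₀ ∈ W) : ∃ B : ℝ, ∀ᶠ r in 𝓝 u, |θ (r • e₀) (fun _ => e₀)| ≤ B := by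
  obtain ⟨s, ε, hε, h⟩ := hθ.exists_isCylindricalAt hu
  obtain ⟨η, h1, h2⟩ := h (u • e₀) (fun p _ => by simpa using hε)
  have hc : Tendsto (fun r : ℝ => restrictCoords s (r • e₀)) (𝓝 u)
      (𝓝 (restrictCoords s (u • e₀))) := by
    have : Continuous fun r : ℝ => restrictCoords s (r • e₀) := by fun_prop
    exact this.tendsto u
  have h3 : ContinuousAt (fun a => |η a (restrictCoords s e₀)|) (restrictCoords s (u • e₀)) :=
    (h1.continuousAt.clm_apply continuousAt_const).abs
  refine ⟨|η (restrictCoords s (u • e₀)) (restrictCoords s e₀)| + 1, ?_⟩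
  filter_upwards [hc.eventually h2, hc.eventually (h3.eventually (gt_mem_nhds (lt_add_one _)))]
    with r hr hr'
  rw [hr _ rfl]
  exact hr'.le

/-- Extension of coordinates by zero. -/
noncomputable def extendCoords (s : Finset JetIdx) : (s → ℝ) →L[ℝ] JetSpace :=
  ContinuousLinearMap.pi fun p =>
    if hp : p ∈ s then (ContinuousLinearMap.proj (⟨p, hp⟩ : s) : (s → ℝ) →L[ℝ] ℝ) else 0

theorem extendCoords_apply {s : Finset JetIdx} {p : JetIdx} (hp : p ∈ s) (a : s → ℝ) :
    extendCoords s a p = a ⟨p, hp⟩ := by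
  simp [extendCoords, hp]

theorem restrictCoords_extendCoords (s : Finset JetIdx) (a : s → ℝ) :
    restrictCoords s (extendCoords s a) = a := by
  funext p
  exact extendCoords_apply p.2 a

/-- The 1-form `θ` on the slice where all coordinates outside `s` vanish. -/
noncomputable def sliceForm (θ : JetSpace → JetSpace [⋀^Fin 1]→L[ℝ] ℝ) (s : Finset JetIdx)
    (a : s → ℝ) : (s → ℝ) →L[ℝ] ℝ :=
  ((ContinuousAlternatingMap.ofSubsingleton ℝ JetSpace ℝ (0 : Fin 1)).symm
    (θ (extendCoords s a))).comp (extendCoords s)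

theorem sliceForm_apply (s : Finset JetIdx) (a v : s → ℝ) :
    sliceForm θ s a v = θ (extendCoords s a) (fun _ => extendCoords s v) := rfl

theorem IsCylindricalAt.contDiffAt_sliceForm {s : Finset JetIdx} {a : s → ℝ}
    (h : IsCylindricalAt θ s (extendCoords s a)) : ContDiffAt ℝ ∞ (sliceForm θ s) a := by
  obtain ⟨η, h1, h2⟩ := h
  rw [restrictCoords_extendCoords] at h1 h2
  refine h1.congr_of_eventuallyEq ?_
  filter_upwards [h2] with b hb
  ext1 v
  rw [sliceForm_apply, hb _ (restrictCoords_extendCoords s b), restrictCoords_extendCoords]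

/-- A cylindrical form ignores the coordinates outside `s`, in the point and in the vector, so
setting them to zero loses nothing. -/
theorem IsCylindricalAt.apply_eq {s : Finset JetIdx} {z : JetSpace} (h : IsCylindricalAt θ s z)
    (v : JetSpace) :
    θ z (fun _ => v) = sliceForm θ s (restrictCoords s z) (restrictCoords s v) := by
  obtain ⟨η, _, h2⟩ := h
  have h3 := h2.self_of_nhds
  rw [sliceForm_apply, h3 z rfl, h3 _ (restrictCoords_extendCoords s _),
    restrictCoords_extendCoords]

theorem removeNth_zero_pair {E : Type*} (a b : E) :
    (0 : Fin 2).removeNth ![a, b] = fun _ : Fin 1 => b := by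
  funext i
  rw [Subsingleton.elim i 0]
  rfl

theorem removeNth_one_pair {E : Type*} (a b : E) :
    (1 : Fin 2).removeNth ![a, b] = fun _ : Fin 1 => a := by
  funext i
  rw [Subsingleton.elim i 0]
  rfl

/-- On the slice, closedness becomes symmetry of the Fréchet derivative, the hypothesis of the
Poincaré lemma on a convex open set. -/
theorem formDeriv_extendCoords {s : Finset JetIdx} {a : s → ℝ}
    (hd : DifferentiableAt ℝ (sliceForm θ s) a) (v w : s → ℝ) :
    formDeriv θ (extendCoords s a) ![extendCoords s v, extendCoords s w] =
      fderiv ℝ (sliceForm θ s) a v w - fderiv ℝ (sliceForm θ s) a w v := by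
  have key : ∀ v w : s → ℝ,
      lineDeriv ℝ (fun z => θ z (fun _ => extendCoords s w)) (extendCoords s a)
        (extendCoords s v) = fderiv ℝ (sliceForm θ s) a v w := by
    intro v w
    have h1 : HasDerivAt (fun t : ℝ => a + t • v) v 0 := by
      simpa using ((hasDerivAt_id (0 : ℝ)).smul_const v).const_add a
    have h2 : HasFDerivAt (sliceForm θ s) (fderiv ℝ (sliceForm θ s) a) (a + (0 : ℝ) • v) := by
      simpa using hd.hasFDerivAt
    have h3 : HasDerivAt (fun t : ℝ => sliceForm θ s (a + t • v))
        (fderiv ℝ (sliceForm θ s) a v) 0 := 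
      HasFDerivAt.comp_hasDerivAt (f := fun t : ℝ => a + t • v) (0 : ℝ) h2 h1
    have h4 : HasDerivAt (fun t : ℝ => sliceForm θ s (a + t • v) w)
        (fderiv ℝ (sliceForm θ s) a v w) 0 :=
      (ContinuousLinearMap.apply ℝ ℝ w).hasFDerivAt.comp_hasDerivAt (0 : ℝ) h3
    rw [← h4.deriv]
    simp only [lineDeriv, sliceForm_apply, map_add, map_smul]
  rw [formDeriv, Fin.sum_univ_two]
  simp only [removeNth_zero_pair, removeNth_one_pair]
  rw [show ![extendCoords s v, extendCoords s w] 0 = extendCoords s v from rfl,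
    show ![extendCoords s v, extendCoords s w] 1 = extendCoords s w from rfl, key, key]
  simp
  ring

/-- A function on a convex set that is invariant up to a constant under a translation becomes, on
subtracting a linear function, bounded on a tube. -/
theorem exists_bound_of_periodic {s : Finset JetIdx} (hs : idx0 ∈ s) {ε : ℝ} (hε : 0 < ε)
    {F : (s → ℝ) → ℝ} {c : ℝ}
    (hF : ContinuousOn F {a | ∀ p : s, (p : JetIdx) ≠ idx0 → |a p| < ε})
    (hc : ∀ a ∈ {a : s → ℝ | ∀ p : s, (p : JetIdx) ≠ idx0 → |a p| < ε},
      F (a + Pi.single ⟨idx0, hs⟩ 1) = F a + c) :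
    ∃ B : ℝ, ∀ a : s → ℝ, (∀ p : s, (p : JetIdx) ≠ idx0 → |a p| < ε / 2) →
      |F a - c * a ⟨idx0, hs⟩| ≤ B := by
  set i0 : s := ⟨idx0, hs⟩ with hi0
  set C : Set (s → ℝ) := {a | ∀ p : s, (p : JetIdx) ≠ idx0 → |a p| < ε} with hC
  -- A compact box that contains a fundamental domain of the smaller tube; halving `ε` keeps the
  -- closed box in the open tube.
  let lo : s → ℝ := fun p => if p = i0 then 0 else -(ε / 2)
  let hi : s → ℝ := fun p => if p = i0 then 1 else ε / 2
  have hne : ∀ p : s, (p : JetIdx) ≠ idx0 ↔ p ≠ i0 := fun p => by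
    rw [ne_eq, ne_eq, Subtype.ext_iff (a1 := p)]
  have hKC : Icc lo hi ⊆ C := by
    intro a ha p hp
    have hp' := (hne p).1 hp
    have h1 := ha.1 p
    have h2 := ha.2 p
    simp only [lo, hi, hp', if_false] at h1 h2
    rw [abs_lt]
    constructor <;> linarith
  have hG : ContinuousOn (fun a => F a - c * a i0) (Icc lo hi) :=
    (hF.mono hKC).sub (by fun_prop)
  obtain ⟨B, hB⟩ := (isCompact_Icc (a := lo) (b := hi)).exists_bound_of_continuousOn hG
  refine ⟨B, fun a ha => ?_⟩
  have haC : ∀ t : ℝ, a + t • Pi.single i0 1 ∈ C := by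
    intro t p hp
    have hp' := (hne p).1 hp
    simp only [Pi.add_apply, Pi.smul_apply, Pi.single_apply, hp', if_false, smul_zero, add_zero]
    linarith [ha p hp]
  have hper : Function.Periodic (fun t : ℝ => F (a + t • Pi.single i0 1) - c * (a i0 + t)) 1 := by
    intro t
    have := hc _ (haC t)
    simp only
    rw [add_smul, one_smul, ← add_assoc, this]
    ring
  -- The shift `t` brings the coordinate `y₀` into `[0, 1)`, hence the point into the box.
  obtain ⟨t, ht, hta⟩ := hper.exists_mem_Ico one_pos 0 (-a i0)
  simp only [zero_smul, add_zero] at hta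
  rw [hta]
  have := hB (a + t • Pi.single i0 1) ⟨fun p => ?_, fun p => ?_⟩
  · simpa [Real.norm_eq_abs] using this
  · by_cases hp : p = i0
    · subst hp
      simp [lo]
      linarith [ht.1]
    · have := abs_lt.1 (ha p ((hne p).2 hp))
      simp [lo, hp]
      linarith
  · by_cases hp : p = i0
    · subst hp
      simp [hi]
      linarith [ht.2]
    · have := abs_lt.1 (ha p ((hne p).2 hp))
      simp [hi, hp]
      linarith

/-- A 1-form on the model space that is periodic in `y₀` and has differential `dy₂ ∧ dy₀` equals
`y₂ dy₀ + dF` near the line of all points with `y₂ = y₃ = ⋯ = 0`, where `F` is a linear function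
of `y₀` up to a bounded error. -/
theorem IsSmoothForm.exists_primitive (hθ : IsSmoothForm univ θ)
    (hper : ∀ y, θ (y + e₀) = θ y) (hd : ∀ y v, formDeriv θ y v = dy2_wedge_dy0 v) :
    ∃ (s : Finset JetIdx) (ε : ℝ) (F : JetSpace → ℝ) (c B : ℝ), 0 < ε ∧
      ∀ z : JetSpace, (∀ p ∈ s, p ≠ idx0 → |z p| < ε) →
        |F z - c * z idx0| ≤ B ∧
        ∀ (Y : ℝ → JetSpace) (Y' : JetSpace) (r : ℝ), Y r = z →
          (∀ p, HasDerivAt (fun x => Y x p) (Y' p) r) →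
          HasDerivAt (fun x => F (Y x)) (θ z (fun _ => Y') - z idx2 * Y' idx0) r := by
  obtain ⟨s, ε, h0, h2, hε, hcyl⟩ := hθ.exists_tube hper
  set i0 : s := ⟨idx0, h0⟩ with hi0
  set i2 : s := ⟨idx2, h2⟩ with hi2
  set C : Set (s → ℝ) := {a | ∀ p : s, (p : JetIdx) ≠ idx0 → |a p| < ε} with hC
  have hCo : IsOpen C := by
    have : C = ⋂ p : s, {a | (p : JetIdx) ≠ idx0 → |a p| < ε} := by
      ext a; simp [hC]
    rw [this]
    refine isOpen_iInter_of_finite fun p => ?_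
    by_cases hp : (p : JetIdx) = idx0
    · simp [hp]
    · simp only [ne_eq, hp, not_false_eq_true, forall_const]
      exact isOpen_lt (by fun_prop) continuous_const
  have hCc : Convex ℝ C := by
    have : C = ⋂ p : s, {a | (p : JetIdx) ≠ idx0 → |a p| < ε} := by
      ext a; simp [hC]
    rw [this]
    refine convex_iInter fun p => ?_
    by_cases hp : (p : JetIdx) = idx0
    · simp [hp, convex_univ]
    · simp only [ne_eq, hp, not_false_eq_true, forall_const]
      have := (convex_ball (0 : ℝ) ε).linear_preimage (LinearMap.proj (R := ℝ) p : (s → ℝ) →ₗ[ℝ] ℝ)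
      have e : {a : s → ℝ | |a p| < ε} =
          (LinearMap.proj (R := ℝ) p : (s → ℝ) →ₗ[ℝ] ℝ) ⁻¹' Metric.ball 0 ε := by
        refine Set.ext fun a => ?_
        change |a p| < ε ↔ dist (a p) 0 < ε
        rw [Real.dist_eq, sub_zero]
      rwa [e]
  have hcylC : ∀ a ∈ C, IsCylindricalAt θ s (extendCoords s a) := fun a ha =>
    hcyl _ fun p hp hp0 => by rw [extendCoords_apply hp]; exact ha ⟨p, hp⟩ hp0
  have hdiff : ∀ a ∈ C, DifferentiableAt ℝ (sliceForm θ s) a := fun a ha =>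
    (hcylC a ha).contDiffAt_sliceForm.differentiableAt (by simp)
  let P0 : (s → ℝ) →L[ℝ] ℝ := ContinuousLinearMap.proj i0
  let P2 : (s → ℝ) →L[ℝ] ℝ := ContinuousLinearMap.proj i2
  -- This is `θ - y₂ dy₀`, closed because both terms have differential `dy₂ ∧ dy₀`.
  let α : (s → ℝ) → (s → ℝ) →L[ℝ] ℝ := fun a => sliceForm θ s a - P2 a • P0
  have hα : ∀ a ∈ C, HasFDerivAt α (fderiv ℝ (sliceForm θ s) a - P2.smulRight P0) a :=
    fun a ha => (hdiff a ha).hasFDerivAt.sub (P2.hasFDerivAt.smul_const P0)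
  obtain ⟨F, hF⟩ := hCc.exists_forall_hasFDerivAt_of_fderiv_symmetric hCo
    (fun a ha => (hα a ha).differentiableAt.differentiableWithinAt) (by
      intro a ha v w
      have := hd (extendCoords s a) ![extendCoords s v, extendCoords s w]
      rw [formDeriv_extendCoords (hdiff a ha)] at this
      have e : dy2_wedge_dy0 ![extendCoords s v, extendCoords s w] =
          v i2 * w i0 - v i0 * w i2 := by
        change extendCoords s v idx2 * extendCoords s w idx0 -
          extendCoords s v idx0 * extendCoords s w idx2 = _
        simp only [extendCoords_apply h0, extendCoords_apply h2, hi0, hi2]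
      rw [e] at this
      have hx : ∀ v w, (fderiv ℝ (sliceForm θ s) a - P2.smulRight P0) v w =
          fderiv ℝ (sliceForm θ s) a v w - v i2 * w i0 := fun _ _ => rfl
      rw [(hα a ha).fderiv, hx, hx]
      linarith)
  have hext : extendCoords s (Pi.single i0 1) = e₀ := by
    funext p
    by_cases hp : p ∈ s
    · rw [extendCoords_apply hp]
      by_cases hp0 : p = idx0
      · subst hp0; simp [hi0]
      · rw [e₀_apply hp0, Pi.single_apply, if_neg]
        intro h; exact hp0 (congrArg Subtype.val h)
    · have hp0 : p ≠ idx0 := fun h => hp (h ▸ h0)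
      simp [extendCoords, hp, e₀_apply hp0]
  have hCt : ∀ a ∈ C, a + Pi.single i0 1 ∈ C := by
    intro a ha p hp
    have hp' : p ≠ i0 := fun h => hp (by rw [h])
    simpa [Pi.single_apply, hp'] using ha p hp
  have hαper : ∀ a, α (a + Pi.single i0 1) = α a := by
    intro a
    have h1 : sliceForm θ s (a + Pi.single i0 1) = sliceForm θ s a := by
      ext1 v
      rw [sliceForm_apply, sliceForm_apply, map_add, hext, hper]
    have h3 : (Pi.single i0 1 : s → ℝ) i2 = 0 := by
      have : i2 ≠ i0 := by simp [hi0, hi2]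
      simp [this]
    have h4 : P2 (a + Pi.single i0 1) = P2 a := by
      change a i2 + (Pi.single i0 1 : s → ℝ) i2 = a i2
      rw [h3, add_zero]
    simp only [α, h1, h4]
  have hzero : (0 : s → ℝ) ∈ C := fun p _ => by simpa using hε
  -- Since `α` is periodic, the increment of `F` over one period has zero derivative on a convex
  -- set. Its constant value is the slope `c`.
  have hconst : ∀ a ∈ C, F (a + Pi.single i0 1) = F a + (F (0 + Pi.single i0 1) - F 0) := by
    intro a ha
    have hD : ∀ b ∈ C, HasFDerivAt (fun b => F (b + Pi.single i0 1) - F b)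
        (0 : (s → ℝ) →L[ℝ] ℝ) b := by
      intro b hb
      have h1 := (hasFDerivAt_comp_add_right (Pi.single i0 1)).2 (hF _ (hCt b hb))
      have h3 := h1.sub (hF b hb)
      rwa [hαper, sub_self] at h3
    have := hCc.is_const_of_fderivWithin_eq_zero (𝕜 := ℝ)
      (f := fun b => F (b + Pi.single i0 1) - F b)
      (fun b hb => (hD b hb).differentiableAt.differentiableWithinAt)
      (fun b hb => by
        rw [fderivWithin_of_isOpen hCo hb]
        exact (hD b hb).fderiv) ha hzero
    linarith
  obtain ⟨B, hB⟩ := exists_bound_of_periodic h0 hε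
    (fun a ha => (hF a ha).continuousAt.continuousWithinAt) hconst
  refine ⟨s, ε / 2, fun z => F (restrictCoords s z), F (0 + Pi.single i0 1) - F 0, B,
    half_pos hε, fun z hz => ⟨?_, ?_⟩⟩
  · exact hB (restrictCoords s z) fun p hp => hz p p.2 hp
  -- Differentiability coordinate by coordinate is enough, as `F` uses only the finitely many
  -- coordinates in `s`.
  · intro Y Y' r hY hY'
    subst hY
    have hzC : restrictCoords s (Y r) ∈ C := fun p hp => by
      have := hz p p.2 hp
      change |Y r p| < ε
      linarith
    have h1 : HasDerivAt (fun x => restrictCoords s (Y x)) (restrictCoords s Y') r :=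
      hasDerivAt_pi.2 fun p => hY' p
    have h3 := (hF _ hzC).comp_hasDerivAt r h1
    refine h3.congr_deriv ?_
    have hc := hcyl (Y r) fun p hp hp0 => by linarith [hz p hp hp0]
    rw [hc.apply_eq]
    rfl

end OneForms

/-! ### Functions that are flat at the end of an interval -/

theorem ContDiffAt.smooth_deriv {u : ℝ → ℝ} {r : ℝ} (hu : ContDiffAt ℝ ∞ u r) :
    ContDiffAt ℝ ∞ (deriv u) r :=
  hu.derivWithin (by simp)

theorem ContDiffAt.smooth_iteratedDeriv {u : ℝ → ℝ} {r : ℝ} (hu : ContDiffAt ℝ ∞ u r) (p : ℕ) :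
    ContDiffAt ℝ ∞ (iteratedDeriv p u) r := by
  induction p with
  | zero => simpa using hu
  | succ p ih =>
    rw [iteratedDeriv_succ]
    exact ih.smooth_deriv

/-- This permits differentiating identities known only on some interval to the left of `b`. -/
theorem eventually_nhds_of_eventually_nhdsLT {b : ℝ} {P : ℝ → Prop} (h : ∀ᶠ r in 𝓝[<] b, P r) :
    ∀ᶠ r in 𝓝[<] b, ∀ᶠ x in 𝓝 r, P x := by
  filter_upwards [eventually_eventually_nhdsWithin.2 h, self_mem_nhdsWithin] with r hr hrb
  rwa [isOpen_Iio.nhdsWithin_eq hrb] at hr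

/-- The function `u` is smooth on an interval `(b - ε, b)` and tends to zero at `b`, together with
all its derivatives. -/
structure IsFlatLeft (u : ℝ → ℝ) (b : ℝ) : Prop where
  smooth : ∀ᶠ r in 𝓝[<] b, ContDiffAt ℝ ∞ u r
  tendsto : ∀ p : ℕ, Tendsto (iteratedDeriv p u) (𝓝[<] b) (𝓝 0)

namespace IsFlatLeft

variable {u v : ℝ → ℝ} {b : ℝ}

theorem congr (hu : IsFlatLeft u b) (h : v =ᶠ[𝓝[<] b] u) : IsFlatLeft v b := by
  have h' := eventually_nhds_of_eventually_nhdsLT h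
  constructor
  · filter_upwards [hu.smooth, h'] with r hr hr'
    exact hr.congr_of_eventuallyEq hr'
  · intro p
    refine (hu.tendsto p).congr' ?_
    filter_upwards [h'] with r hr
    exact (EventuallyEq.iteratedDeriv_eq p hr).symm

theorem deriv (hu : IsFlatLeft u b) : IsFlatLeft (deriv u) b := by
  refine ⟨hu.smooth.mono fun r hr => hr.smooth_deriv, fun p => ?_⟩
  simpa only [iteratedDeriv_succ'] using hu.tendsto (p + 1)

theorem neg (hu : IsFlatLeft u b) : IsFlatLeft (fun x => -u x) b := by
  refine ⟨hu.smooth.mono fun r hr => hr.neg, fun p => ?_⟩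
  have := (hu.tendsto p).neg
  rw [neg_zero] at this
  exact this.congr fun r => (iteratedDeriv_fun_neg p u r).symm

theorem add (hu : IsFlatLeft u b) (hv : IsFlatLeft v b) : IsFlatLeft (fun x => u x + v x) b := by
  refine ⟨(hu.smooth.and hv.smooth).mono fun r hr => hr.1.add hr.2, fun p => ?_⟩
  have := (hu.tendsto p).add (hv.tendsto p)
  rw [add_zero] at this
  refine this.congr' ?_
  filter_upwards [hu.smooth, hv.smooth] with r hr hr'
  exact (iteratedDeriv_fun_add (contDiffAt_infty.1 hr p) (contDiffAt_infty.1 hr' p)).symm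

theorem mul (hu : IsFlatLeft u b) (hv : IsFlatLeft v b) : IsFlatLeft (fun x => u x * v x) b := by
  refine ⟨(hu.smooth.and hv.smooth).mono fun r hr => hr.1.mul hr.2, fun p => ?_⟩
  have : Tendsto (fun r => ∑ i ∈ Finset.range (p + 1),
      p.choose i * iteratedDeriv i u r * iteratedDeriv (p - i) v r) (𝓝[<] b) (𝓝 0) := by
    rw [← Finset.sum_const_zero (s := Finset.range (p + 1))]
    refine tendsto_finsetSum _ fun i _ => ?_
    simpa using ((hu.tendsto i).const_mul (p.choose i : ℝ)).mul (hv.tendsto (p - i))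
  refine this.congr' ?_
  filter_upwards [hu.smooth, hv.smooth] with r hr hr'
  exact (iteratedDeriv_fun_mul (contDiffAt_infty.1 hr p) (contDiffAt_infty.1 hr' p)).symm

theorem const_mul (c : ℝ) (hu : IsFlatLeft u b) : IsFlatLeft (fun x => c * u x) b := by
  refine ⟨hu.smooth.mono fun r hr => contDiffAt_const.mul hr, fun p => ?_⟩
  have := (hu.tendsto p).const_mul c
  rw [mul_zero] at this
  refine this.congr' ?_
  filter_upwards [hu.smooth] with r hr
  exact (iteratedDeriv_const_mul c (contDiffAt_infty.1 hr p)).symm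

end IsFlatLeft

/-- If the reciprocal of `h'` is flat at the end of an interval, then so are the normalized higher
derivatives of `h`. -/
theorem isFlatLeft_iteratedDeriv_div {h : ℝ → ℝ} {b : ℝ}
    (hs : ∀ᶠ r in 𝓝[<] b, ContDiffAt ℝ ∞ h r) (hne : ∀ᶠ r in 𝓝[<] b, deriv h r ≠ 0)
    (hw : IsFlatLeft (fun r => 1 / deriv h r) b) (p : ℕ) :
    IsFlatLeft (fun r => iteratedDeriv (p + 2) h r / deriv h r ^ (p + 2)) b := by
  have hd : ∀ᶠ r in 𝓝[<] b, HasDerivAt (fun r => 1 / deriv h r)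
      (-deriv (deriv h) r / deriv h r ^ 2) r := by
    filter_upwards [hs, hne] with r hr hr0
    have := ((hr.smooth_deriv.differentiableAt (by simp)).hasDerivAt).inv hr0
    simp only [one_div]
    exact this
  induction p with
  | zero =>
    -- The start of the recursion: `h''/h'² = -(1/h')'`.
    refine hw.deriv.neg.congr ?_
    filter_upwards [hd] with r hr
    rw [hr.deriv, iteratedDeriv_succ, iteratedDeriv_one]
    ring
  | succ p ih =>
    -- With `w = 1/h'` and `vₙ = h⁽ⁿ⁾/h'ⁿ`, the quotient rule gives `vₙ₊₁ = w vₙ' - n w' vₙ`, here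
    -- for `n = p + 2`.
    refine ((hw.mul ih.deriv).add ((hw.deriv.mul ih).const_mul (-((p : ℝ) + 2)))).congr ?_
    filter_upwards [hd, hs, hne] with r hr hsr hr0
    have h1 : HasDerivAt (iteratedDeriv (p + 2) h) (iteratedDeriv (p + 3) h r) r := by
      rw [iteratedDeriv_succ (n := p + 2)]
      exact ((hsr.smooth_iteratedDeriv (p + 2)).differentiableAt (by simp)).hasDerivAt
    have h2 := ((hsr.smooth_deriv.differentiableAt (by simp)).hasDerivAt).pow (p + 2)
    have h3 := h1.div h2 (pow_ne_zero _ hr0)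
    have h4 : deriv (fun r => iteratedDeriv (p + 2) h r / deriv h r ^ (p + 2)) r = _ := h3.deriv
    rw [h4, hr.deriv]
    simp only [Pi.pow_apply, Nat.cast_add, Nat.cast_ofNat, Nat.add_succ_sub_one]
    rw [show p + 1 + 2 = p + 3 from rfl]
    field_simp
    ring

theorem exists_Ioo_of_eventually_nhdsLT {b : ℝ} {P : ℝ → Prop} (h : ∀ᶠ r in 𝓝[<] b, P r) :
    ∃ l < b, ∀ r ∈ Ioo l b, P r := by
  obtain ⟨l, hl, hP⟩ := mem_nhdsLT_iff_exists_Ioo_subset.1 h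
  exact ⟨l, hl, fun r hr => hP hr⟩

/-- If `h` and `h'` tend to infinity while the derivative of `1 / h'` tends to zero, then `log h'`
is not a linear function of `h` up to a bounded error. -/
theorem not_eventually_bounded_add_log_deriv {h : ℝ → ℝ} {b : ℝ}
    (hs : ∀ᶠ r in 𝓝[<] b, ContDiffAt ℝ ∞ h r)
    (hinf : Tendsto (fun r => |h r|) (𝓝[<] b) atTop)
    (hdinf : Tendsto (fun r => |deriv h r|) (𝓝[<] b) atTop)
    (hflat : Tendsto (fun r => deriv (deriv h) r / deriv h r ^ 2) (𝓝[<] b) (𝓝 0)) (c B : ℝ) :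
    ¬ ∀ᶠ r in 𝓝[<] b, |c * h r + Real.log (deriv h r)| ≤ B := by
  intro hB
  have hne : ∀ᶠ r in 𝓝[<] b, deriv h r ≠ 0 :=
    (hdinf.eventually_gt_atTop 0).mono fun r hr => abs_pos.1 hr
  have hsmall : ∀ η > 0, ∀ᶠ r in 𝓝[<] b, |deriv (deriv h) r / deriv h r ^ 2| < η := by
    intro η hη
    have := hflat.abs
    rw [abs_zero] at this
    exact this.eventually (gt_mem_nhds hη)
  -- Cauchy's mean value theorem for `log h'` against `h`; the quotient of the derivatives is
  -- `h''/h'²`.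
  have hslope : ∀ l, (∀ r ∈ Ioo l b, ContDiffAt ℝ ∞ h r ∧ deriv h r ≠ 0) → ∀ x ∈ Ioo l b,
      ∀ y ∈ Ioo x b, ∃ z ∈ Ioo l b, Real.log (deriv h y) - Real.log (deriv h x) =
        (h y - h x) * (deriv (deriv h) z / deriv h z ^ 2) := by
    intro l hl x hx y hy
    have h1 : ∀ r ∈ Ioo l b, HasDerivAt h (deriv h r) r := fun r hr =>
      ((hl r hr).1.differentiableAt (by simp)).hasDerivAt
    have h2 : ∀ r ∈ Ioo l b, HasDerivAt (fun r => Real.log (deriv h r))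
        (deriv (deriv h) r / deriv h r) r := fun r hr =>
      (((hl r hr).1.smooth_deriv.differentiableAt (by simp)).hasDerivAt).log (hl r hr).2
    have hsub : Icc x y ⊆ Ioo l b := fun r hr => ⟨hx.1.trans_le hr.1, hr.2.trans_lt hy.2⟩
    obtain ⟨z, hz, e⟩ := exists_ratio_hasDerivAt_eq_ratio_slope
      (fun r => Real.log (deriv h r)) (fun r => deriv (deriv h) r / deriv h r) hy.1
      (fun r hr => (h2 r (hsub hr)).continuousAt.continuousWithinAt)
      (fun r hr => h2 r (hsub (Ioo_subset_Icc_self hr))) h (deriv h)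
      (fun r hr => (h1 r (hsub hr)).continuousAt.continuousWithinAt)
      (fun r hr => h1 r (hsub (Ioo_subset_Icc_self hr)))
    have hz' := hsub (Ioo_subset_Icc_self hz)
    refine ⟨z, hz', ?_⟩
    have hz0 := (hl z hz').2
    field_simp at e ⊢
    linarith
  by_cases hc : c = 0
  · subst hc
    have : Tendsto (fun r => Real.log |deriv h r|) (𝓝[<] b) atTop :=
      Real.tendsto_log_atTop.comp hdinf
    obtain ⟨r, h1, h2⟩ := (hB.and (this.eventually_gt_atTop B)).exists
    rw [Real.log_abs] at h2
    rw [zero_mul, zero_add] at h1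
    linarith [le_abs_self (Real.log (deriv h r))]
  · have hc' : 0 < |c| := abs_pos.2 hc
    -- With the bound `|c|/2` on `h''/h'²`, the logarithm can cancel at most half of the variation
    -- of `c h`.
    obtain ⟨l, hl, hP⟩ := exists_Ioo_of_eventually_nhdsLT
      ((hs.and hne).and (hB.and (hsmall (|c| / 2) (by linarith))))
    obtain ⟨x, hx⟩ := nonempty_Ioo.2 hl
    -- The estimate `|c| |Δh| ≤ 2B + |c| |Δh| / 2` forces `|Δh| ≤ 4B/|c|`, and `y` is chosen to
    -- violate it.
    obtain ⟨y, hy, hybig⟩ := (Eventually.and (p := fun r => r ∈ Ioo x b)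
      (Ioo_mem_nhdsLT hx.2) (hinf.eventually_gt_atTop (|h x| + 4 * B / |c|))).exists
    obtain ⟨z, hz, e⟩ := hslope l (fun r hr => (hP r hr).1) x hx y hy
    have hy' : y ∈ Ioo l b := ⟨hx.1.trans hy.1, hy.2⟩
    have bx := (hP x hx).2.1
    have by' := (hP y hy').2.1
    have bz := (hP z hz).2.2
    have e1 : |c * (h y - h x)| ≤ 2 * B + |h y - h x| * (|c| / 2) := by
      have e2 : c * (h y - h x) = (c * h y + Real.log (deriv h y)) -
          (c * h x + Real.log (deriv h x)) - (h y - h x) * (deriv (deriv h) z / deriv h z ^ 2) := by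
        rw [← e]; ring
      have e3 : |(h y - h x) * (deriv (deriv h) z / deriv h z ^ 2)| ≤ |h y - h x| * (|c| / 2) := by
        rw [abs_mul]
        exact mul_le_mul_of_nonneg_left bz.le (abs_nonneg _)
      rw [e2]
      calc _ ≤ |c * h y + Real.log (deriv h y)| + |c * h x + Real.log (deriv h x)| +
          |(h y - h x) * (deriv (deriv h) z / deriv h z ^ 2)| :=
            (abs_sub _ _).trans (add_le_add_left (abs_sub _ _) _)
        _ ≤ _ := by linarith
    rw [abs_mul] at e1
    have e4 : |h y - h x| * |c| ≤ 4 * B := by linarith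
    have e5 : |h y - h x| ≤ 4 * B / |c| := (le_div_iff₀ hc').2 e4
    have e6 : |h y| - |h x| ≤ |h y - h x| := abs_sub_abs_le_abs_sub _ _
    linarith

/-! ### Transversals of the Reeb foliation -/

/-- Differentiate `‖z‖² = (re z)² + (im z)²` at a point of the positive real axis, where the radial
direction is the real one. -/
theorem hasDerivAt_norm_of_eq_ofReal {z : ℝ → ℂ} {w : ℂ} {ρ x : ℝ} (hρ : 0 < ρ)
    (hz : HasDerivAt z w x) (h0 : z x = ρ) : HasDerivAt (fun s => ‖z s‖) w.re x := by
  have hre : HasDerivAt (fun s => (z s).re) w.re x :=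
    Complex.reCLM.hasFDerivAt.comp_hasDerivAt x hz
  have him : HasDerivAt (fun s => (z s).im) w.im x :=
    Complex.imCLM.hasFDerivAt.comp_hasDerivAt x hz
  have h1 := (hre.mul hre).add (him.mul him)
  have h2 : HasDerivAt (fun s => (z s).re * (z s).re + (z s).im * (z s).im) (2 * ρ * w.re) x := by
    refine h1.congr_deriv ?_
    rw [h0]
    simp
    ring
  have h3 := h2.sqrt (by rw [h0]; simp; exact hρ.ne')
  have e : (fun s => ‖z s‖) = fun s => √((z s).re * (z s).re + (z s).im * (z s).im) := by
    funext s
    rw [Complex.norm_def, Complex.normSq_apply]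
  rw [e]
  refine h3.congr_deriv ?_
  rw [h0]
  simp only [Complex.ofReal_re, Complex.ofReal_im, mul_zero, add_zero,
    Real.sqrt_mul_self hρ.le]
  field_simp

theorem norm_snd_pos_of_mem_planeLeaf₁ {f : ℝ → ℝ} {a : ℝ} {q : ℂ × ℂ} (hq : q ∈ planeLeaf₁ f a) :
    0 < ‖q.2‖ := by
  have h1 : ‖q.1‖ ^ 2 + ‖q.2‖ ^ 2 = 2 := hq.1
  have h2 : ‖q.1‖ < 1 := hq.2.1
  have h3 := norm_nonneg q.1
  have h4 := norm_nonneg q.2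
  rcases h4.eq_or_lt with h | h
  · rw [← h] at h1; nlinarith
  · exact h

/-- The second component of a tangent vector of a non-compact leaf is determined, up to a real
multiple of the second component of the foot point, by the first component. -/
theorem deriv_snd_of_mem_planeLeaf₁ {f : ℝ → ℝ} {a ρ : ℝ} (hρ : 0 < ρ)
    (hf : DifferentiableAt ℝ f ρ) {c : ℝ → ℂ × ℂ} (hc : ContDiff ℝ ∞ c)
    (hmem : ∀ s, c s ∈ planeLeaf₁ f a) (h0 : (c 0).1 = ρ) :
    ∃ m : ℝ, (deriv c 0).2 = Complex.exp (2 * Real.pi * Complex.I * ((a + f ρ : ℝ) : ℂ)) *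
      (m + ‖(c 0).2‖ * (2 * Real.pi * Complex.I * ((deriv f ρ * (deriv c 0).1.re : ℝ) : ℂ))) := by
  have hd : HasDerivAt c (deriv c 0) 0 := (hc.differentiable (by simp) 0).hasDerivAt
  have hd1 : HasDerivAt (fun s => (c s).1) (deriv c 0).1 0 :=
    (ContinuousLinearMap.fst ℝ ℂ ℂ).hasFDerivAt.comp_hasDerivAt (0 : ℝ) hd
  have hd2 : HasDerivAt (fun s => (c s).2) (deriv c 0).2 0 :=
    (ContinuousLinearMap.snd ℝ ℂ ℂ).hasFDerivAt.comp_hasDerivAt (0 : ℝ) hd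
  have hn1 := hasDerivAt_norm_of_eq_ofReal hρ hd1 h0
  have hn0 : ‖(c 0).1‖ = ρ := by rw [h0]; simp [abs_of_pos hρ]
  have hne : (c 0).2 ≠ 0 := norm_pos_iff.1 (norm_snd_pos_of_mem_planeLeaf₁ (hmem 0))
  have hn2 : HasDerivAt (fun s => ‖(c s).2‖) (deriv (fun s => ‖(c s).2‖) 0) 0 :=
    (hd2.differentiableAt.norm ℝ hne).hasDerivAt
  have hff : HasDerivAt f (deriv f ρ) ‖(c 0).1‖ := by rw [hn0]; exact hf.hasDerivAt
  have hphase : HasDerivAt (fun s => a + f ‖(c s).1‖) (deriv f ρ * (deriv c 0).1.re) 0 :=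
    (hff.comp (0 : ℝ) hn1).const_add a
  have hexp := (hphase.ofReal_comp.const_mul (2 * Real.pi * Complex.I)).cexp
  have hprod := hn2.ofReal_comp.mul hexp
  have e : (fun s => (c s).2) = (fun s => ((‖(c s).2‖ : ℝ) : ℂ)) *
      fun s => Complex.exp (2 * Real.pi * Complex.I * ((a + f ‖(c s).1‖ : ℝ) : ℂ)) := by
    funext s
    exact (hmem s).2.2
  -- The number `m` is the radial speed; what matters later is only that it is real.
  refine ⟨deriv (fun s => ‖(c s).2‖) 0, ?_⟩
  rw [e] at hd2
  rw [hd2.unique hprod, hn0]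
  ring

/-- Exchanging the two complex coordinates reduces tangency in the second solid torus to the first.
-/
theorem swap_mem_planeLeaf₁ {g : ℝ → ℝ} {a : ℝ} {q : ℂ × ℂ} (hq : q ∈ planeLeaf₂ g a) :
    q.swap ∈ planeLeaf₁ g a :=
  ⟨by have h : ‖q.1‖ ^ 2 + ‖q.2‖ ^ 2 = 2 := hq.1
      change ‖q.2‖ ^ 2 + ‖q.1‖ ^ 2 = 2
      linarith, hq.2.1, hq.2.2⟩

/-! ### Two transversals: a circle in the first solid torus and a curve through the compact leaf -/

/-- The leaf through a point of the sphere. -/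
noncomputable def leafOf (f g : ℝ → ℝ) (q : ℂ × ℂ) (hq : q ∈ sphere3) : ReebLeafSpace f g :=
  ⟨(existsUnique_reebLeaf f g q hq).exists.choose,
    (existsUnique_reebLeaf f g q hq).exists.choose_spec.1⟩

theorem mem_leafOf (f g : ℝ → ℝ) {q : ℂ × ℂ} (hq : q ∈ sphere3) :
    q ∈ (leafOf f g q hq : Set (ℂ × ℂ)) :=
  (existsUnique_reebLeaf f g q hq).exists.choose_spec.2

theorem leafOf_eq {f g : ℝ → ℝ} {q : ℂ × ℂ} (hq : q ∈ sphere3) (L : ReebLeafSpace f g)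
    (hL : q ∈ (L : Set (ℂ × ℂ))) : leafOf f g q hq = L :=
  Subtype.ext ((existsUnique_reebLeaf f g q hq).unique
    ⟨(leafOf f g q hq).2, mem_leafOf f g hq⟩ ⟨L.2, hL⟩)

/-- The leaf with number `a` of the first solid torus, as a point of the leaf space. -/
def leafPoint₁ (f g : ℝ → ℝ) (a : ℝ) : ReebLeafSpace f g :=
  ⟨planeLeaf₁ f a, Or.inl (Or.inr ⟨a, rfl⟩)⟩

/-- The leaf with number `a` of the second solid torus, as a point of the leaf space. -/
def leafPoint₂ (f g : ℝ → ℝ) (a : ℝ) : ReebLeafSpace f g :=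
  ⟨planeLeaf₂ g a, Or.inr ⟨a, rfl⟩⟩

/-- The compact leaf, as a point of the leaf space. -/
def leafPointTorus (f g : ℝ → ℝ) : ReebLeafSpace f g :=
  ⟨torusLeaf, Or.inl (Or.inl rfl)⟩

/-- This makes the translation by `1` an automorphism of `circleChart`, the source of all
periodicity. -/
theorem planeLeaf₁_add_one (f : ℝ → ℝ) (a : ℝ) : planeLeaf₁ f (a + 1) = planeLeaf₁ f a := by
  have h : ∀ t : ℝ, Complex.exp (2 * Real.pi * Complex.I * ((a + 1 + t : ℝ) : ℂ)) =
      Complex.exp (2 * Real.pi * Complex.I * ((a + t : ℝ) : ℂ)) := by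
    intro t
    rw [← Complex.exp_periodic (2 * Real.pi * Complex.I * ((a + t : ℝ) : ℂ))]
    congr 1
    push_cast
    ring
  simp only [planeLeaf₁, h]

/-- The chart of the leaf space that numbers the leaves of the first solid torus. -/
def circleChart (f g : ℝ → ℝ) : LineChart (ReebLeafSpace f g) where
  dom := ⊤
  toFun u := leafPoint₁ f g u

/-- The numbering lifts to a circle at `x = 1/2`, where `|y|² = 2 - 1/4 = 7/4`. Its velocity is
purely angular in `y` and zero in `x`, whereas a leaf tangent with zero `x`-component is purely
radial in `y`. -/
theorem circleChart_mem_reebCharts {f : ℝ → ℝ} (g : ℝ → ℝ) (hf : DifferentiableAt ℝ f (1 / 2)) :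
    circleChart f g ∈ reebCharts f g := by
  have hpos : 0 < √(7 / 4 : ℝ) := by positivity
  have hder : ∀ u : ℝ, HasDerivAt (fun u : ℝ => ((((1 / 2 : ℝ) : ℂ),
      ((√(7 / 4) : ℝ) : ℂ) * Complex.exp (2 * Real.pi * Complex.I * ((u + f (1 / 2) : ℝ) : ℂ)))
        : ℂ × ℂ))
      (0, ((√(7 / 4) : ℝ) : ℂ) * (Complex.exp (2 * Real.pi * Complex.I *
        ((u + f (1 / 2) : ℝ) : ℂ)) * (2 * Real.pi * Complex.I))) u := by
    intro u
    have h1 : HasDerivAt (fun u : ℝ => u + f (1 / 2)) 1 u := (hasDerivAt_id u).add_const _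
    have h2 := ((h1.ofReal_comp.const_mul (2 * Real.pi * Complex.I)).cexp).const_mul
      ((√(7 / 4) : ℝ) : ℂ)
    refine (hasDerivAt_const u (((1 / 2 : ℝ) : ℂ))).prodMk (h2.congr_deriv ?_)
    simp
  refine ⟨fun u => (((1 / 2 : ℝ) : ℂ),
    ((√(7 / 4) : ℝ) : ℂ) * Complex.exp (2 * Real.pi * Complex.I * ((u + f (1 / 2) : ℝ) : ℂ))),
    ?_, ?_⟩
  · refine ContDiff.contDiffOn ?_
    have h1 : ContDiff ℝ ∞ (fun u : ℝ => ((u + f (1 / 2) : ℝ) : ℂ)) :=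
      Complex.ofRealCLM.contDiff.comp (contDiff_id.add contDiff_const)
    exact contDiff_const.prodMk (contDiff_const.mul (contDiff_const.mul h1).cexp)
  · intro u _
    have hphase : ‖Complex.exp (2 * Real.pi * Complex.I * ((u + f (1 / 2) : ℝ) : ℂ))‖ = 1 := by
      rw [show 2 * Real.pi * Complex.I * ((u + f (1 / 2) : ℝ) : ℂ) =
        ((2 * Real.pi * (u + f (1 / 2)) : ℝ) : ℂ) * Complex.I by push_cast; ring]
      exact Complex.norm_exp_ofReal_mul_I _
    have hn1 : ‖((1 / 2 : ℝ) : ℂ)‖ = 1 / 2 := by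
      rw [Complex.norm_real]; norm_num
    have hn2 : ‖((√(7 / 4) : ℝ) : ℂ) *
        Complex.exp (2 * Real.pi * Complex.I * ((u + f (1 / 2) : ℝ) : ℂ))‖ = √(7 / 4) := by
      rw [norm_mul, hphase, mul_one, Complex.norm_real, Real.norm_of_nonneg hpos.le]
    refine ⟨⟨?_, ?_, ?_⟩, ?_⟩
    · change ‖((1 / 2 : ℝ) : ℂ)‖ ^ 2 + ‖_‖ ^ 2 = 2
      rw [hn2, hn1, Real.sq_sqrt (by norm_num)]
      norm_num
    · change ‖((1 / 2 : ℝ) : ℂ)‖ < 1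
      rw [hn1]; norm_num
    · change _ = ((‖_‖ : ℝ) : ℂ) *
        Complex.exp (2 * Real.pi * Complex.I * ((u + f ‖((1 / 2 : ℝ) : ℂ)‖ : ℝ) : ℂ))
      rw [hn2, hn1]
    · rintro ⟨c, hc, hmem, hc0, hcd⟩
      obtain ⟨m, hm⟩ := deriv_snd_of_mem_planeLeaf₁ (by norm_num : (0 : ℝ) < 1 / 2) hf hc hmem
        (by rw [hc0])
      rw [hcd, (hder u).deriv, hc0] at hm
      -- The first component of the velocity vanishes, which removes the `f'` term; a real number
      -- would then equal `√(7/4) · 2πi`.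
      simp only [Complex.zero_re, mul_zero, Complex.ofReal_zero, add_zero] at hm
      have hm' := mul_left_cancel₀ (Complex.exp_ne_zero _)
        ((mul_left_comm _ _ _).symm.trans hm)
      have him := congrArg Complex.im hm'
      simp at him

/-- The chart of the leaf space given by a curve in the sphere. -/
noncomputable def curveChart (f g : ℝ → ℝ) (U : TopologicalSpace.Opens ℝ) (c : ℝ → ℂ × ℂ)
    (hc : ∀ u ∈ U, c u ∈ sphere3) : LineChart (ReebLeafSpace f g) where
  dom := U
  toFun u := leafOf f g (c u) (hc u u.2)

/-- A curve in the sphere that crosses the compact leaf. -/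
noncomputable def crossingCurve (r : ℝ) : ℂ × ℂ := ((r : ℂ), ((√(2 - r ^ 2) : ℝ) : ℂ))

theorem crossingCurve_mem_sphere3 {r : ℝ} (hr : r ^ 2 < 2) : crossingCurve r ∈ sphere3 := by
  change ‖(r : ℂ)‖ ^ 2 + ‖((√(2 - r ^ 2) : ℝ) : ℂ)‖ ^ 2 = 2
  rw [Complex.norm_real, Complex.norm_real, Real.norm_eq_abs, Real.norm_eq_abs, sq_abs, sq_abs,
    Real.sq_sqrt (by linarith)]
  ring

theorem hasDerivAt_sqrt_two_sub_sq {r : ℝ} (hr : r ^ 2 < 2) :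
    HasDerivAt (fun r : ℝ => √(2 - r ^ 2)) (-(r / √(2 - r ^ 2))) r := by
  have h1 : HasDerivAt (fun r : ℝ => 2 - r ^ 2) (-(2 * r)) r := by
    simpa using ((hasDerivAt_id r).pow 2).const_sub 2
  refine (h1.sqrt (by linarith)).congr_deriv ?_
  have : √(2 - r ^ 2) ≠ 0 := (Real.sqrt_pos.2 (by linarith)).ne'
  field_simp

theorem hasDerivAt_crossingCurve {r : ℝ} (hr : r ^ 2 < 2) :
    HasDerivAt crossingCurve ((1 : ℂ), ((-(r / √(2 - r ^ 2)) : ℝ) : ℂ)) r := by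
  have h1 : HasDerivAt (fun r : ℝ => (r : ℂ)) 1 r := by
    simpa using (hasDerivAt_id r).ofReal_comp
  exact h1.prodMk (hasDerivAt_sqrt_two_sub_sq hr).ofReal_comp

theorem contDiffAt_crossingCurve {r : ℝ} (hr : r ^ 2 < 2) : ContDiffAt ℝ ∞ crossingCurve r := by
  have h1 : ContDiffAt ℝ ∞ (fun r : ℝ => √(2 - r ^ 2)) r :=
    (contDiffAt_const.sub (contDiffAt_id.pow 2)).sqrt (by simp; linarith)
  exact (Complex.ofRealCLM.contDiff.contDiffAt).prodMk
    (Complex.ofRealCLM.contDiff.contDiffAt.comp r h1)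

/-- The second coordinate is a positive real, so its phase vanishes and the leaf number is `-f r`.
This is the morphism `h = -f`. -/
theorem crossingCurve_mem_planeLeaf₁ (f : ℝ → ℝ) {r : ℝ} (h0 : 0 < r) (h1 : r < 1) :
    crossingCurve r ∈ planeLeaf₁ f (-f r) := by
  refine ⟨crossingCurve_mem_sphere3 (by nlinarith), ?_, ?_⟩
  · change ‖(r : ℂ)‖ < 1
    rwa [Complex.norm_real, Real.norm_of_nonneg h0.le]
  · change ((√(2 - r ^ 2) : ℝ) : ℂ) = ((‖((√(2 - r ^ 2) : ℝ) : ℂ)‖ : ℝ) : ℂ) *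
      Complex.exp (2 * Real.pi * Complex.I * ((-f r + f ‖(r : ℂ)‖ : ℝ) : ℂ))
    rw [Complex.norm_real, Complex.norm_real, Real.norm_of_nonneg h0.le,
      Real.norm_of_nonneg (Real.sqrt_nonneg _)]
    simp

theorem crossingCurve_mem_planeLeaf₂ (g : ℝ → ℝ) {r : ℝ} (h0 : 1 < r) (h1 : r ^ 2 < 2) :
    crossingCurve r ∈ planeLeaf₂ g (-g √(2 - r ^ 2)) := by
  refine ⟨crossingCurve_mem_sphere3 h1, ?_, ?_⟩
  · change ‖((√(2 - r ^ 2) : ℝ) : ℂ)‖ < 1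
    rw [Complex.norm_real, Real.norm_of_nonneg (Real.sqrt_nonneg _), Real.sqrt_lt' one_pos]
    nlinarith
  · change (r : ℂ) = ((‖(r : ℂ)‖ : ℝ) : ℂ) *
      Complex.exp (2 * Real.pi * Complex.I *
        ((-g √(2 - r ^ 2) + g ‖((√(2 - r ^ 2) : ℝ) : ℂ)‖ : ℝ) : ℂ))
    rw [Complex.norm_real, Complex.norm_real, Real.norm_of_nonneg (by linarith : 0 ≤ r),
      Real.norm_of_nonneg (Real.sqrt_nonneg _)]
    simp

theorem crossingCurve_one_mem_torusLeaf : crossingCurve 1 ∈ torusLeaf := by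
  refine ⟨crossingCurve_mem_sphere3 (by norm_num), ?_⟩
  change ‖((1 : ℝ) : ℂ)‖ = ‖((√(2 - 1 ^ 2) : ℝ) : ℂ)‖
  norm_num

/-- At phase zero the imaginary part of the second component is `2π |y| f'(ρ)` times the radial
speed of the first. The velocity of the crossing curve has real components, so it cannot be tangent
to the leaf. -/
theorem leafTangent_planeLeaf₁_ne {f : ℝ → ℝ} {a ρ : ℝ} (hρ : 0 < ρ)
    (hf : DifferentiableAt ℝ f ρ) (hf0 : deriv f ρ ≠ 0) (ha : a + f ρ = 0) {q w : ℂ × ℂ}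
    (hq : q.1 = ρ) (hw : w ∈ leafTangent (planeLeaf₁ f a) q) (hw1 : w.1.re ≠ 0) :
    w.2.im ≠ 0 := by
  obtain ⟨c, hc, hmem, hc0, hcd⟩ := hw
  subst hc0 hcd
  obtain ⟨m, hm⟩ := deriv_snd_of_mem_planeLeaf₁ hρ hf hc hmem hq
  have hpos := norm_snd_pos_of_mem_planeLeaf₁ (hmem 0)
  rw [hm, ha]
  have : ((m : ℂ) + ‖(c 0).2‖ * (2 * Real.pi * Complex.I *
      ((deriv f ρ * (deriv c 0).1.re : ℝ) : ℂ))) =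
      (m : ℂ) + ((‖(c 0).2‖ * (2 * Real.pi * (deriv f ρ * (deriv c 0).1.re)) : ℝ) : ℂ) *
        Complex.I := by
    push_cast; ring
  rw [this]
  simp only [Complex.ofReal_zero, mul_zero, Complex.exp_zero, one_mul, Complex.add_im,
    Complex.ofReal_im, Complex.mul_im, Complex.ofReal_re, Complex.I_im, Complex.I_re, mul_one,
    add_zero, zero_add]
  have := Real.pi_pos
  positivity

/-- On the torus `|x|` is constantly `1`, so curves in it have no radial speed. -/
theorem leafTangent_torusLeaf_re {q w : ℂ × ℂ} (hq : q.1 = (1 : ℝ))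
    (hw : w ∈ leafTangent torusLeaf q) : w.1.re = 0 := by
  obtain ⟨c, hc, hmem, hc0, hcd⟩ := hw
  subst hc0 hcd
  have hd : HasDerivAt c (deriv c 0) 0 := (hc.differentiable (by simp) 0).hasDerivAt
  have hd1 : HasDerivAt (fun s => (c s).1) (deriv c 0).1 0 :=
    (ContinuousLinearMap.fst ℝ ℂ ℂ).hasFDerivAt.comp_hasDerivAt (0 : ℝ) hd
  have hn := hasDerivAt_norm_of_eq_ofReal one_pos hd1 hq
  have e : (fun s => ‖(c s).1‖) = fun _ => (1 : ℝ) := by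
    funext s
    have h1 : ‖(c s).1‖ ^ 2 + ‖(c s).2‖ ^ 2 = 2 := (hmem s).1
    have h2 : ‖(c s).1‖ = ‖(c s).2‖ := (hmem s).2
    rw [← h2] at h1
    nlinarith [norm_nonneg (c s).1]
  rw [e] at hn
  exact hn.unique (hasDerivAt_const 0 1)

/-- The curve that crosses the compact leaf is transverse to the leaves where the functions that
define the foliation have non-zero derivatives. -/
theorem curveChart_mem_reebCharts {f g : ℝ → ℝ} {U : TopologicalSpace.Opens ℝ}
    (hU : ∀ r ∈ U, 0 < r ∧ r ^ 2 < 2)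
    (hf : ∀ r ∈ U, r < 1 → DifferentiableAt ℝ f r ∧ deriv f r ≠ 0)
    (hg : ∀ r ∈ U, 1 < r → DifferentiableAt ℝ g √(2 - r ^ 2) ∧ deriv g √(2 - r ^ 2) ≠ 0) :
    curveChart f g U crossingCurve (fun r hr => crossingCurve_mem_sphere3 (hU r hr).2) ∈
      reebCharts f g := by
  refine ⟨crossingCurve, fun r hr => (contDiffAt_crossingCurve (hU r hr).2).contDiffWithinAt,
    fun r hr => ⟨mem_leafOf f g (crossingCurve_mem_sphere3 (hU r hr).2), ?_⟩⟩
  have hr0 := (hU r hr).1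
  have hr2 := (hU r hr).2
  have hsq : 0 < √(2 - r ^ 2) := Real.sqrt_pos.2 (by linarith)
  rw [(hasDerivAt_crossingCurve hr2).deriv]
  change _ ∉ leafTangent
    (leafOf f g (crossingCurve r) (crossingCurve_mem_sphere3 hr2) : Set (ℂ × ℂ)) _
  rcases lt_trichotomy r 1 with h1 | h1 | h1
  · rw [leafOf_eq _ (leafPoint₁ f g (-f r)) (crossingCurve_mem_planeLeaf₁ f hr0 h1)]
    intro hw
    exact leafTangent_planeLeaf₁_ne hr0 (hf r hr h1).1 (hf r hr h1).2 (by ring) rfl hw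
      (by simp) (Complex.ofReal_im _)
  · subst h1
    rw [leafOf_eq _ (leafPointTorus f g) crossingCurve_one_mem_torusLeaf]
    intro hw
    have := leafTangent_torusLeaf_re rfl hw
    simp at this
  · rw [leafOf_eq _ (leafPoint₂ f g (-g √(2 - r ^ 2))) (crossingCurve_mem_planeLeaf₂ g h1 hr2)]
    rintro ⟨c, hc, hmem, hc0, hcd⟩
    -- The swap of coordinates, as a linear map that transports curves in the leaf and their
    -- velocities.
    let L : (ℂ × ℂ) →L[ℝ] (ℂ × ℂ) :=
      (ContinuousLinearMap.snd ℝ ℂ ℂ).prod (ContinuousLinearMap.fst ℝ ℂ ℂ)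
    have hd : HasDerivAt c (deriv c 0) 0 := (hc.differentiable (by simp) 0).hasDerivAt
    have hw : (((-(r / √(2 - r ^ 2)) : ℝ) : ℂ), (1 : ℂ)) ∈
        leafTangent (planeLeaf₁ g (-g √(2 - r ^ 2))) (crossingCurve r).swap := by
      refine ⟨fun s => L (c s), L.contDiff.comp hc, fun s => swap_mem_planeLeaf₁ (hmem s), ?_, ?_⟩
      · exact congrArg L hc0
      · have h3 : HasDerivAt (fun s => L (c s)) (L (deriv c 0)) 0 :=
          L.hasFDerivAt.comp_hasDerivAt (0 : ℝ) hd
        rw [h3.deriv, hcd]; rfl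
    refine leafTangent_planeLeaf₁_ne hsq (hg r hr h1).1 (hg r hr h1).2 (by ring) rfl hw ?_
      Complex.one_im
    rw [Complex.ofReal_re]
    exact neg_ne_zero.2 (div_ne_zero hr0.ne' hsq.ne')

/-! ### The first Chern form of the Reeb foliation -/

theorem IsReebFunction.eventually_contDiffAt {f : ℝ → ℝ} (hf : IsReebFunction f) :
    ∀ᶠ r in 𝓝[<] (1 : ℝ), ContDiffAt ℝ ∞ f r := by
  filter_upwards [Ioo_mem_nhdsLT (by norm_num : (-1 : ℝ) < 1)] with r hr
  exact hf.smooth.contDiffAt (isOpen_Ioo.mem_nhds hr)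

theorem IsReebFunction.eventually_deriv_ne_zero {f : ℝ → ℝ} (hf : IsReebFunction f) :
    ∀ᶠ r in 𝓝[<] (1 : ℝ), deriv f r ≠ 0 := by
  have := hf.deriv_right 1
  simp only [iteratedDeriv_one] at this
  exact (this.eventually_gt_atTop 0).mono fun r hr => abs_pos.1 hr

theorem IsReebFunction.isFlatLeft {f : ℝ → ℝ} (hf : IsReebFunction f) :
    IsFlatLeft (fun r => 1 / deriv f r) 1 :=
  ⟨(hf.eventually_contDiffAt.and hf.eventually_deriv_ne_zero).mono fun _ hr =>
    contDiffAt_const.div hr.1.smooth_deriv hr.2, hf.flat_right⟩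

theorem tendsto_sqrt_two_sub_sq :
    Tendsto (fun r : ℝ => √(2 - r ^ 2)) (𝓝[>] 1) (𝓝[<] 1) := by
  refine tendsto_nhdsWithin_iff.2 ⟨?_, ?_⟩
  · have h : Continuous fun r : ℝ => √(2 - r ^ 2) := by fun_prop
    have := h.tendsto 1
    norm_num at this
    exact this.mono_left nhdsWithin_le_nhds
  · filter_upwards [self_mem_nhdsWithin] with r (hr : 1 < r)
    change √(2 - r ^ 2) < 1
    rw [Real.sqrt_lt' one_pos]
    nlinarith

theorem IsReebFunction.exists_transverse_interval {f g : ℝ → ℝ} (hf : IsReebFunction f)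
    (hg : IsReebFunction g) : ∃ l u : ℝ, l < 1 ∧ 1 < u ∧ (∀ r ∈ Ioo l u, 0 < r ∧ r ^ 2 < 2) ∧
      (∀ r ∈ Ioo l 1, ContDiffAt ℝ ∞ f r ∧ deriv f r ≠ 0) ∧
      ∀ r ∈ Ioo 1 u, DifferentiableAt ℝ g √(2 - r ^ 2) ∧ deriv g √(2 - r ^ 2) ≠ 0 := by
  obtain ⟨l, hl, h1⟩ := exists_Ioo_of_eventually_nhdsLT
    ((hf.eventually_contDiffAt.and hf.eventually_deriv_ne_zero))
  have h2 := tendsto_sqrt_two_sub_sq.eventually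
    (hg.eventually_contDiffAt.and hg.eventually_deriv_ne_zero)
  obtain ⟨u, hu, h3⟩ := mem_nhdsGT_iff_exists_Ioo_subset.1 h2
  -- The bounds `0` and `6/5` secure `r > 0` and `r² < 36/25 < 2`.
  refine ⟨max l 0, min u (6 / 5), max_lt hl one_pos, lt_min hu (by norm_num), ?_, ?_, ?_⟩
  · intro r hr
    have h4 := (le_max_right l 0).trans_lt hr.1
    have h5 := hr.2.trans_le (min_le_right u (6 / 5))
    exact ⟨h4, by nlinarith⟩
  · intro r hr
    exact h1 r ⟨(le_max_left l 0).trans_lt hr.1, hr.2⟩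
  · intro r hr
    have := h3 ⟨hr.1, hr.2.trans_le (min_le_left u (6 / 5))⟩
    exact ⟨this.1.differentiableAt (by simp), this.2⟩

/-- There is no periodic 1-form on the model space with differential `dy₂ ∧ dy₀` whose pull-back
by `h` remains bounded where `h` and `h'` tend to infinity and `1 / h'` is flat. -/
theorem not_eventually_bounded_pullback {θ : JetSpace → JetSpace [⋀^Fin 1]→L[ℝ] ℝ}
    (hθ : IsSmoothForm univ θ) (hper : ∀ y, θ (y + e₀) = θ y)
    (hd : ∀ y v, formDeriv θ y v = dy2_wedge_dy0 v) {h : ℝ → ℝ} {b : ℝ}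
    (hs : ∀ᶠ r in 𝓝[<] b, ContDiffAt ℝ ∞ h r)
    (hinf : Tendsto (fun r => |h r|) (𝓝[<] b) atTop)
    (hdinf : Tendsto (fun r => |deriv h r|) (𝓝[<] b) atTop)
    (hflat : IsFlatLeft (fun r => 1 / deriv h r) b) (K : ℝ) :
    ¬ ∀ᶠ r in 𝓝[<] b,
      |θ (pushJet h (r • e₀)) (fun _ => pushJetDeriv h (r • e₀) e₀)| ≤ K := by
  intro hK
  have hne : ∀ᶠ r in 𝓝[<] b, deriv h r ≠ 0 :=
    (hdinf.eventually_gt_atTop 0).mono fun r hr => abs_pos.1 hr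
  -- The higher coordinates are the normalized derivatives of `h`, which are flat at `b`; this
  -- drives the jets into the tube.
  have hsmall : ∀ p : JetIdx, p ≠ idx0 → Tendsto (fun r : ℝ => pushJet h (r • e₀) p)
      (𝓝[<] b) (𝓝 0) := by
    rintro ⟨p, hp⟩ hp0
    obtain ⟨q, rfl⟩ : ∃ q, p = q + 2 := by
      have : p ≠ 0 := fun h0 => hp0 (Subtype.ext h0)
      exact ⟨p - 2, by omega⟩
    simp only [pushJet_smul_e₀]
    exact (isFlatLeft_iteratedDeriv_div hs hne hflat q).tendsto 0 |>.congr fun r => by simp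
  obtain ⟨s, ε, F, c, B, hε, hF⟩ := hθ.exists_primitive hper hd
  have htube : ∀ᶠ r in 𝓝[<] b, ∀ p ∈ s, p ≠ idx0 → |pushJet h (r • e₀) p| < ε := by
    rw [Filter.eventually_all_finset]
    intro p _
    by_cases hp : p = idx0
    · exact Eventually.of_forall fun r h => (h hp).elim
    · have := (hsmall p hp).abs
      rw [abs_zero] at this
      exact (this.eventually (gt_mem_nhds hε)).mono fun r hr _ => hr
  obtain ⟨l, hl, hP⟩ := exists_Ioo_of_eventually_nhdsLT ((hs.and hne).and (htube.and hK))
  -- In the tube `θ = dF + y₂ dy₀`, and along the jets of `h` the second term is `(h''/h') dr = d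
  -- log |h'|`; `Real.log` absorbs the sign of `h'`.
  have hder : ∀ r ∈ Ioo l b, HasDerivAt
      (fun r => F (pushJet h (r • e₀)) + Real.log (deriv h r))
      (θ (pushJet h (r • e₀)) (fun _ => pushJetDeriv h (r • e₀) e₀)) r := by
    intro r hr
    obtain ⟨⟨hsr, hr0⟩, htr, -⟩ := hP r hr
    have h1 := (hF (pushJet h (r • e₀)) htr).2 (fun r => pushJet h (r • e₀))
      (pushJetDeriv h (r • e₀) e₀) r rfl (fun p => by
        rw [pushJetDeriv_smul_e₀]
        simp only [pushJet_smul_e₀]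
        refine DifferentiableAt.hasDerivAt ?_
        exact ((hsr.smooth_iteratedDeriv p).differentiableAt (by simp)).div
          ((hsr.smooth_deriv.differentiableAt (by simp)).pow _) (pow_ne_zero _ hr0))
    have h2 := ((hsr.smooth_deriv.differentiableAt (by simp)).hasDerivAt).log hr0
    refine (h1.add h2).congr_deriv ?_
    have hy : (r • e₀) idx0 = r := by simp
    rw [pushJetDeriv_idx0 (by rw [hy]; exact hsr.differentiableAt (by simp)), hy,
      pushJet_smul_e₀, iteratedDeriv_succ, iteratedDeriv_one]
    simp only [e₀_idx0]
    field_simp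
    ring
  obtain ⟨x, hx⟩ := nonempty_Ioo.2 hl
  -- A derivative bounded by `K` on a bounded interval; afterwards `F` may be replaced by `c h` at
  -- the cost of `B`.
  have hbd : ∀ r ∈ Ioo l b, |F (pushJet h (r • e₀)) + Real.log (deriv h r)| ≤
      |F (pushJet h (x • e₀)) + Real.log (deriv h x)| + K * (b - l) := by
    intro r hr
    have h1 := (convex_Ioo l b).norm_image_sub_le_of_norm_hasDerivWithin_le (C := K)
      (fun y hy => (hder y hy).hasDerivWithinAt) (fun y hy => (hP y hy).2.2) hx hr
    rw [Real.norm_eq_abs, Real.norm_eq_abs] at h1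
    have hK0 : 0 ≤ K := (abs_nonneg _).trans (hP x hx).2.2
    have h2 : |r - x| ≤ b - l := by
      rw [abs_le]
      constructor <;> linarith [hr.1, hr.2, hx.1, hx.2]
    have h3 := mul_le_mul_of_nonneg_left h2 hK0
    have h4 := abs_sub_abs_le_abs_sub (F (pushJet h (r • e₀)) + Real.log (deriv h r))
      (F (pushJet h (x • e₀)) + Real.log (deriv h x))
    linarith
  refine not_eventually_bounded_add_log_deriv hs hinf hdinf ?_ c
    (|F (pushJet h (x • e₀)) + Real.log (deriv h x)| + K * (b - l) + B) ?_
  · refine ((isFlatLeft_iteratedDeriv_div hs hne hflat 0).tendsto 0).congr fun r => ?_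
    rw [iteratedDeriv_zero, iteratedDeriv_succ, iteratedDeriv_one]
  · filter_upwards [Ioo_mem_nhdsLT hl] with r hr
    have h1 := (hF _ (hP r hr).2.1).1
    rw [pushJet_idx0] at h1
    have hy : (r • e₀) idx0 = r := by simp
    rw [hy] at h1
    have h2 := hbd r hr
    rw [abs_le] at h1 h2 ⊢
    constructor <;> linarith [h1.1, h1.2, h2.1, h2.2]

theorem not_isExactFrameForm_reebCharts {f g : ℝ → ℝ} (hf : IsReebFunction f)
    (hg : IsReebFunction g) :
    ¬ IsExactFrameForm (reebCharts f g) (firstChernForm (ReebLeafSpace f g)) := by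
  rintro ⟨γ, hγ, hd⟩
  obtain ⟨l, u, hl, hu, hlu, hfr, hgr⟩ := hf.exists_transverse_interval hg
  have hhalf : DifferentiableAt ℝ f (1 / 2) :=
    (hf.smooth.contDiffAt (isOpen_Ioo.mem_nhds (by constructor <;> norm_num))).differentiableAt
      (by simp)
  have hC := circleChart_mem_reebCharts g hhalf
  let U : TopologicalSpace.Opens ℝ := ⟨Ioo l u, isOpen_Ioo⟩
  -- A morphism must be defined on the whole domain of its source, and `-f` relates the crossing
  -- curve to the numbering only for `r < 1`.
  let V : TopologicalSpace.Opens ℝ := ⟨Ioo l 1, isOpen_Ioo⟩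
  have hVU : ∀ r ∈ V, r ∈ U := fun r hr => ⟨hr.1, hr.2.trans hu⟩
  have hU := curveChart_mem_reebCharts (f := f) (g := g) (U := U) hlu
    (fun r hr hr1 => ⟨(hfr r ⟨hr.1, hr1⟩).1.differentiableAt (by simp), (hfr r ⟨hr.1, hr1⟩).2⟩)
    (fun r hr hr1 => hgr r ⟨hr1, hr.2⟩)
  have hV := curveChart_mem_reebCharts (f := f) (g := g) (U := V)
    (fun r hr => hlu r (hVU r hr))
    (fun r hr _ => ⟨(hfr r hr).1.differentiableAt (by simp), (hfr r hr).2⟩)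
    (fun r hr hr1 => absurd hr.2 hr1.not_gt)
  set kU := curveChart f g U crossingCurve (fun r hr => crossingCurve_mem_sphere3 (hlu r hr).2)
  set kV := curveChart f g V crossingCurve
    (fun r hr => crossingCurve_mem_sphere3 (hlu r (hVU r hr)).2)
  have mT : IsChartMorphism (circleChart f g) (circleChart f g) (fun s => s + 1) := by
    refine ⟨by fun_prop, fun x _ => by simp, fun x _ => ⟨trivial, ?_⟩⟩
    exact Subtype.ext (planeLeaf₁_add_one f x)
  -- The inclusion is written as translation by `0` so that its action on jets is already known.
  have mI : IsChartMorphism kV kU (fun s => s + 0) := by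
    refine ⟨by fun_prop, fun x _ => by simp, fun x hx => ?_⟩
    have hx' : x + 0 ∈ kU.dom := by rw [add_zero]; exact hVU x hx
    refine ⟨hx', ?_⟩
    refine leafOf_eq (crossingCurve_mem_sphere3 (hlu _ hx').2) (kV.toFun ⟨x, hx⟩) ?_
    rw [add_zero]
    exact mem_leafOf f g (crossingCurve_mem_sphere3 (hlu x (hVU x hx)).2)
  have mF : IsChartMorphism kV (circleChart f g) (fun r => -f r) := by
    refine ⟨fun r hr => (hfr r hr).1.neg.contDiffWithinAt, fun r hr => ?_,
      fun r hr => ⟨trivial, ?_⟩⟩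
    · rw [deriv.fun_neg]
      exact neg_ne_zero.2 (hfr r hr).2
    · exact (leafOf_eq (crossingCurve_mem_sphere3 (hlu r (hVU r hr)).2)
        (leafPoint₁ f g (-f r))
        (crossingCurve_mem_planeLeaf₁ f (hlu r (hVU r hr)).1 hr.2)).symm
  have hsmooth : IsSmoothForm univ (γ (circleChart f g)) := by
    have := hγ.smooth _ hC
    rwa [show jetDomain ((circleChart f g).dom : Set ℝ) = univ from
      eq_univ_of_forall fun y => trivial] at this
  have hper : ∀ y, γ (circleChart f g) (y + e₀) = γ (circleChart f g) y := by
    intro y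
    ext v
    have := hγ.compat _ hC _ hC _ mT y trivial v
    simp only [pushJet_add_const, pushJetDeriv_add_const, one_smul] at this
    exact this.symm
  obtain ⟨K, hK⟩ := (hγ.smooth _ hU).eventually_bounded (u := 1)
    (show ((1 : ℝ) • e₀) idx0 ∈ Ioo l u by simpa using ⟨hl, hu⟩)
  have hneg : deriv (fun r => -f r) = fun r => -deriv f r := funext fun r => deriv.fun_neg
  refine not_eventually_bounded_pullback hsmooth hper
    (fun y v => hd _ hC y trivial v) (h := fun r => -f r) (b := 1)
    (hf.eventually_contDiffAt.mono fun r hr => hr.neg) ?_ ?_ ?_ K ?_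
  · simpa using hf.deriv_right 0
  · simpa [hneg] using hf.deriv_right 1
  · refine hf.isFlatLeft.neg.congr (Eventually.of_forall fun r => ?_)
    rw [hneg]
    simp only [div_neg]
  -- For `r < 1`, the pull-back of `θ` by `-f` is the component of `γ` on `V`, which is that on `U`,
  -- bounded near `r = 1`.
  · filter_upwards [nhdsWithin_le_nhds hK, Ioo_mem_nhdsLT hl] with r hr hr'
    have hy : (r • e₀) ∈ jetDomain (kV.dom : Set ℝ) := by
      change (r • e₀) idx0 ∈ Ioo l 1
      simpa using hr'
    have h1 := hγ.compat _ hV _ hU _ mI _ hy (fun _ => e₀)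
    have h2 := hγ.compat _ hV _ hC _ mF _ hy (fun _ => e₀)
    simp only [pushJet_add_const, pushJetDeriv_add_const] at h1
    rw [zero_smul, add_zero] at h1
    rw [← h2, h1]
    exact hr

theorem theorem8p1 :
    (∀ f g : ℝ → ℝ, IsReebFunction f → IsReebFunction g →
      IsFrameForm (reebCharts f g) 2 (firstChernForm (ReebLeafSpace f g)) ∧
      IsClosedFrameForm (reebCharts f g) (firstChernForm (ReebLeafSpace f g)) ∧
      ¬ IsExactFrameForm (reebCharts f g) (firstChernForm (ReebLeafSpace f g))) ∧
    (∀ (M : Type*) [TopologicalSpace M] [ChartedSpace ℝ M] [IsManifold 𝓘(ℝ, ℝ) ∞ M]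
      [T2Space M] [SecondCountableTopology M],
      IsFrameForm (manifoldCharts M) 2 (firstChernForm M) ∧
      IsClosedFrameForm (manifoldCharts M) (firstChernForm M) ∧
      IsExactFrameForm (manifoldCharts M) (firstChernForm M)) := by
  refine ⟨fun f g hf hg => ⟨isFrameForm_firstChernForm _, isClosedFrameForm_firstChernForm _,
    not_isExactFrameForm_reebCharts hf hg⟩, ?_⟩
  intro M _ _ _ _ _
  exact ⟨isFrameForm_firstChernForm _, isClosedFrameForm_firstChernForm _,
    isExactFrameForm_manifoldCharts M⟩
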